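/- **Setting.** Let $\mathbf{C}$ be a *topological category*: a category with finite limits and a faithful functor $\mathfrak{z}:\mathbf{C}\to\mathbf{Set}$ that has a fully faithful left adjoint $\mathbf{F}$, such that $\mathbf{F}$ commutes with finite limits and, for every discrete object $D$ and all objects $X,Y$, the natural map $\mathrm{Hom}_{\mathbf{C}}(D\times X,Y)\to \mathrm{Hom}_{\mathbf{Set}}(\mathfrak{z}D,\mathrm{Hom}_{\mathbf{C}}(X,Y))$ is bijective. Here $D$ is *discrete* if $\mathrm{Hom}_{\mathbf{C}}(D,Y)=\mathrm{Hom}_{\mathbf{Set}}(\mathfrak{z}D,\mathfrak{z}Y)$ for all $Y$. A *topologised monoid* is a monoid object in $\mathbf{C}$. For a topologised monoid $G$, a *$G$-module with $\mathbf{C}$-rigidification* is an abelian group $A$ with an action of the monoid $\mathfrak{z}G$ by group endomorphisms, together with a contravariant functor $h_A:\mathbf{C}^{\circ}\to\mathbf{Set}$ such that, functorially in $X$, $h_A(X)$ is a subgroup of $\mathrm{Hom}_{\mathbf{Set}}(\mathfrak{z}X,A)$; $h_A(\mathbf{F}\bullet)=A$ for a singleton $\bullet$; and for each $f\in h_A(X)$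 the map $(g,x)\mapsto g\cdot f(x)$ lies in $h_A(G\times X)$. Put $X^n(G,A)=h_A(G^n)\subseteq\mathrm{Hom}_{\mathbf{Set}}((\mathfrak{z}G)^n,A)$, with the inhomogeneous coboundary $$\partial f(x_1,\dots,x_{n+1})=x_1 f(x_2,\dots,x_{n+1})+\sum_{i=1}^n(-1)^i f(\dots,x_ix_{i+1},\dots)+(-1)^{n+1}f(x_1,\dots,x_n),$$ and $H^n(G,A)=H^n(X^\bullet(G,A),\partial)$. For an abstract monoid $M$ and an $M$-module $B$, $H^n(M,B)$ is the cohomology of the complex of all inhomogeneous cochains $M^n\to B$. A discrete object $D$ is *$A$-pliant* if $h_A(D\times X)=\mathrm{Hom}_{\mathbf{Set}}(\mathfrak{z}D,h_A(X))$ for all $X$. **Proposition 11.17.** Let $G$ be a topologised monoid in $\mathbf{C}$, let $D$ be a discrete abelian topologised monoid in $\mathbf{C}$, and let $A$ be a $D\times G$-module with $\mathbf{C}$-rigidification such that $D$ is $A$-pliant. Let $D$ act on $H^q(G,A)$ through its action on cochains, $(df)(\underline{x})=d\cdot f(\underline{x})$. If $\mathfrak{z}D$ is finite and acts trivially on $A$,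 then for every $n\ge 0$ there is an isomorphism of abelian groups $$H^n(D\times G,A)\;\cong\;\bigoplus_{p+q=n}H^p\bigl(\mathfrak{z}D,\,H^q(G,A)\bigr).$$ -/

import Mathlib

open CategoryTheory MonoidalCategory CartesianMonoidalCategory Limits MonObj
open scoped DirectSum

universe w v u t

namespace TopMon

noncomputable section

/-! ### Cohomology of inhomogeneous cochains -/

section Abstract

variable {M : Type*} [Monoid M] {B : Type*} [AddCommGroup B]

/-- The inhomogeneous coboundary operator for an `M`-module `B` (the action is given by `ρ`):
`∂f (x₁, …, xₙ₊₁) = x₁ • f (x₂, …, xₙ₊₁) + ∑_{i=1}^{n} (-1)^i f (…, xᵢ xᵢ₊₁, …)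
  + (-1)^(n+1) f (x₁, …, xₙ)`.
`Fin.contractNth j` multiplies the entries `j` and `j + 1` (counted from `0`), and drops the last
entry for `j = n`. -/
def coboundary (ρ : M →* AddMonoid.End B) (n : ℕ) :
    ((Fin n → M) → B) →+ ((Fin (n + 1) → M) → B) where
  toFun f x := ρ (x 0) (f fun i => x i.succ) +
    ∑ j : Fin (n + 1), (-1 : ℤ) ^ ((j : ℕ) + 1) • f (Fin.contractNth j (· * ·) x)
  map_zero' := by
    funext x
    simp
  map_add' f g := by
    funext x
    simp [Finset.sum_add_distrib, add_add_add_comm]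

/-- The cocycles among the cochains that lie in the groups `K n`. -/
def cocycles (ρ : M →* AddMonoid.End B) (K : ∀ n : ℕ, AddSubgroup ((Fin n → M) → B)) (n : ℕ) :
    AddSubgroup ((Fin n → M) → B) :=
  K n ⊓ (coboundary ρ n).ker

/-- The coboundaries of the cochains that lie in the groups `K n`. -/
def coboundaries (ρ : M →* AddMonoid.End B) (K : ∀ n : ℕ, AddSubgroup ((Fin n → M) → B)) :
    ∀ n : ℕ, AddSubgroup ((Fin n → M) → B)
  | 0 => ⊥
  | n + 1 => (K n).map (coboundary ρ n)

/-- Cocycles modulo coboundaries, for the cochains that lie in the groups `K n`. -/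
abbrev CochainCohomology (ρ : M →* AddMonoid.End B)
    (K : ∀ n : ℕ, AddSubgroup ((Fin n → M) → B)) (n : ℕ) : Type _ :=
  cocycles ρ K n ⧸ (coboundaries ρ K n).addSubgroupOf (cocycles ρ K n)

/-- The cohomology of the abstract monoid `M` with coefficients in the `M`-module `B`:
all inhomogeneous cochains are allowed. -/
abbrev MonoidCohomology (ρ : M →* AddMonoid.End B) (n : ℕ) : Type _ :=
  CochainCohomology ρ (fun _ => ⊤) n

/-- Composition of cochains with an endomorphism of the coefficients. -/
def postcomp (φ : AddMonoid.End B) (n : ℕ) : ((Fin n → M) → B) →+ ((Fin n → M) → B) where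
  toFun f x := φ (f x)
  map_zero' := by
    funext x
    simp
  map_add' f g := by
    funext x
    simp

lemma coboundary_postcomp (ρ : M →* AddMonoid.End B) (φ : AddMonoid.End B)
    (hφ : ∀ m b, φ (ρ m b) = ρ m (φ b)) (n : ℕ) (f : (Fin n → M) → B) :
    coboundary ρ n (postcomp φ n f) = postcomp φ (n + 1) (coboundary ρ n f) := by
  funext x
  simp [coboundary, postcomp, hφ]

lemma postcomp_mem_cocycles (ρ : M →* AddMonoid.End B)
    (K : ∀ n : ℕ, AddSubgroup ((Fin n → M) → B)) (φ : AddMonoid.End B)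
    (hφ : ∀ m b, φ (ρ m b) = ρ m (φ b)) (hK : ∀ n, ∀ f ∈ K n, postcomp φ n f ∈ K n) (n : ℕ)
    (f : (Fin n → M) → B) (hf : f ∈ cocycles ρ K n) : postcomp φ n f ∈ cocycles ρ K n := by
  refine ⟨hK n f hf.1, ?_⟩
  have h : coboundary ρ n f = 0 := hf.2
  show coboundary ρ n (postcomp φ n f) = 0
  rw [coboundary_postcomp ρ φ hφ, h, map_zero]

lemma postcomp_mem_coboundaries (ρ : M →* AddMonoid.End B)
    (K : ∀ n : ℕ, AddSubgroup ((Fin n → M) → B)) (φ : AddMonoid.End B)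
    (hφ : ∀ m b, φ (ρ m b) = ρ m (φ b)) (hK : ∀ n, ∀ f ∈ K n, postcomp φ n f ∈ K n) (n : ℕ)
    (f : (Fin n → M) → B) (hf : f ∈ coboundaries ρ K n) :
    postcomp φ n f ∈ coboundaries ρ K n := by
  cases n with
  | zero =>
    have h : f = 0 := hf
    rw [h, map_zero]
    exact zero_mem _
  | succ n =>
    obtain ⟨g, hg, rfl⟩ := hf
    exact ⟨postcomp φ n g, hK n g hg, coboundary_postcomp ρ φ hφ n g⟩

/-- The endomorphism of the cohomology induced by an endomorphism of the coefficients that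
commutes with the action and preserves the admissible cochains. -/
def cohomologyMap (ρ : M →* AddMonoid.End B) (K : ∀ n : ℕ, AddSubgroup ((Fin n → M) → B))
    (φ : AddMonoid.End B) (hφ : ∀ m b, φ (ρ m b) = ρ m (φ b))
    (hK : ∀ n, ∀ f ∈ K n, postcomp φ n f ∈ K n) (n : ℕ) :
    AddMonoid.End (CochainCohomology ρ K n) :=
  QuotientAddGroup.map _ _
    (((postcomp φ n).comp (cocycles ρ K n).subtype).codRestrict (cocycles ρ K n)
      fun f => postcomp_mem_cocycles ρ K φ hφ hK n f f.2)
    fun f hf => postcomp_mem_coboundaries ρ K φ hφ hK n f hf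

end Abstract

/-! ### Topological categories -/

/-- The data of a category admitting discrete objects: a faithful functor `forget` to sets
together with a fully faithful left adjoint `free`, on a category with finite limits.
The monoidal structure of `C` is the one given by (chosen) finite products. -/
structure DiscreteObjects (C : Type u) [Category.{v} C] [CartesianMonoidalCategory C]
    [HasFiniteLimits C] where
  /-- the forgetful functor to sets -/
  forget : C ⥤ Type w
  /-- the left adjoint of the forgetful functor -/
  free : Type w ⥤ C
  /-- the adjunction -/
  adj : free ⊣ forget
  faithful_forget : forget.Faithful
  full_free : free.Full
  faithful_free : free.Faithful

namespace DiscreteObjects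

variable {C : Type u} [Category.{v} C] [CartesianMonoidalCategory C] [HasFiniteLimits C]

section

variable (T : DiscreteObjects.{w} C)

/-- An object `D` is discrete if every map of sets from `D` to any object is a morphism. -/
def IsDiscrete (D : C) : Prop :=
  ∀ Y : C, Function.Bijective fun f : D ⟶ Y => T.forget.map f

/-- The forgetful functor is represented by the free object on a singleton. -/
def elt (X : C) : T.forget.obj X ≃ (T.free.obj PUnit ⟶ X) :=
  ((Equiv.funUnique PUnit (T.forget.obj X)).symm.trans TypeCat.homEquiv.symm).trans
    (T.adj.homEquiv PUnit X).symm

lemma elt_naturality {X Y : C} (f : X ⟶ Y) (x : T.forget.obj X) :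
    T.elt Y (T.forget.map f x) = T.elt X x ≫ f := by
  simp only [elt, Equiv.trans_apply]
  rw [← T.adj.homEquiv_naturality_right_symm]
  rfl

lemma elt_symm_naturality {X Y : C} (f : X ⟶ Y) (x : T.free.obj PUnit ⟶ X) :
    (T.elt Y).symm (x ≫ f) = T.forget.map f ((T.elt X).symm x) := by
  rw [Equiv.symm_apply_eq, elt_naturality, Equiv.apply_symm_apply]

section Slice

variable [PreservesFiniteLimits T.free]

/-- The constant morphism with value `d`: it factors over the free object on a singleton, which is
terminal. -/
def const {D : C} (X : C) (d : T.forget.obj D) : X ⟶ D :=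
  (IsTerminal.isTerminalObj T.free _ Types.isTerminalPUnit).from X ≫ T.elt D d

lemma const_apply {D : C} (X : C) (d : T.forget.obj D) (x : T.forget.obj X) :
    T.forget.map (T.const X d) x = d := by
  apply (T.elt D).injective
  rw [elt_naturality, const, ← Category.assoc]
  have h : T.elt X x ≫ (IsTerminal.isTerminalObj T.free _ Types.isTerminalPUnit).from X = 𝟙 _ :=
    (IsTerminal.isTerminalObj T.free _ Types.isTerminalPUnit).hom_ext _ _
  rw [h, Category.id_comp]

/-- The morphism `x ↦ (d, x)`. -/
def slice {D : C} (X : C) (d : T.forget.obj D) : X ⟶ D ⊗ X :=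
  lift (T.const X d) (𝟙 X)

lemma fst_slice {D : C} (X : C) (d : T.forget.obj D) (x : T.forget.obj X) :
    T.forget.map (fst D X) (T.forget.map (T.slice X d) x) = d := by
  rw [← Functor.map_comp_apply, slice, lift_fst, const_apply]

lemma snd_slice {D : C} (X : C) (d : T.forget.obj D) (x : T.forget.obj X) :
    T.forget.map (snd D X) (T.forget.map (T.slice X d) x) = x := by
  rw [← Functor.map_comp_apply, slice, lift_snd, CategoryTheory.Functor.map_id]
  rfl

end Slice

/-- A category admitting discrete objects is topological if `free` commutes with finite limits and
`Hom (D × X, Y) → Map (D, Hom (X, Y))` is bijective for all `X`, `Y` and all discrete `D`. -/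
class IsTopological : Prop where
  preservesFiniteLimits : PreservesFiniteLimits T.free
  bijective : ∀ D : C, T.IsDiscrete D → ∀ X Y : C,
    Function.Bijective fun (f : D ⊗ X ⟶ Y) (d : T.forget.obj D) => T.slice X d ≫ f

attribute [instance] IsTopological.preservesFiniteLimits

/-- The underlying set of a topologised monoid is a monoid. -/
instance instMonoidObj (G : C) [MonObj G] : Monoid (T.forget.obj G) :=
  (T.elt G).monoid

lemma elt_mul {G : C} [MonObj G] (x y : T.forget.obj G) :
    T.elt G (x * y) = T.elt G x * T.elt G y :=
  (T.elt G).apply_symm_apply _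

lemma elt_one {G : C} [MonObj G] : T.elt G 1 = 1 :=
  (T.elt G).apply_symm_apply _

/-- A morphism of topologised monoids induces a homomorphism on the underlying monoids. -/
def mapHom {G H : C} [MonObj G] [MonObj H] (f : G ⟶ H) [IsMonHom f] :
    T.forget.obj G →* T.forget.obj H where
  toFun x := T.forget.map f x
  map_one' := by
    apply (T.elt H).injective
    rw [elt_naturality, elt_one, elt_one]
    exact map_one (IsMonHom.monoidHom f (T.free.obj PUnit))
  map_mul' x y := by
    apply (T.elt H).injective
    rw [elt_naturality, elt_mul, elt_mul, elt_naturality, elt_naturality]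
    exact map_mul (IsMonHom.monoidHom f (T.free.obj PUnit)) _ _

end

/-! ### Rigidified modules -/

/-- A rigidification of the set `Y`: a contravariant functor with `maps X ⊆ Map (X, Y)`
such that `maps` of the free object on a singleton is all of `Y`. -/
structure Rigidification (T : DiscreteObjects.{w} C) (Y : Type t) where
  /-- the admissible maps from `X` to `Y` -/
  maps : ∀ X : C, Set (T.forget.obj X → Y)
  comp_mem : ∀ {X X' : C} (f : X' ⟶ X) (φ : T.forget.obj X → Y), φ ∈ maps X →
    (fun x => φ (T.forget.map f x)) ∈ maps X'
  point_mem : ∀ φ : T.forget.obj (T.free.obj PUnit) → Y, φ ∈ maps (T.free.obj PUnit)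

/-- The discrete object `D` is `Y`-pliant: `maps (D × X)` consists of all maps whose slices
`x ↦ f (d, x)` all lie in `maps X`, i.e. `maps (D × X) = Map (D, maps X)`. -/
structure Rigidification.IsPliant {T : DiscreteObjects.{w} C} [T.IsTopological] {Y : Type t}
    (h : T.Rigidification Y) (D : C) : Prop where
  isDiscrete : T.IsDiscrete D
  mem_iff : ∀ (X : C) (f : T.forget.obj (D ⊗ X) → Y),
    f ∈ h.maps (D ⊗ X) ↔ ∀ d : T.forget.obj D, (fun x => f (T.forget.map (T.slice X d) x)) ∈ h.maps X

/-- A `G`-module with rigidification, with underlying abelian group `A`. -/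
structure RigidModule (T : DiscreteObjects.{w} C) (G : C) [MonObj G] (A : Type t) [AddCommGroup A]
    extends Rigidification T A where
  /-- the action of the underlying monoid of `G` on `A` -/
  action : T.forget.obj G →* AddMonoid.End A
  zero_mem : ∀ X : C, (0 : T.forget.obj X → A) ∈ maps X
  add_mem : ∀ (X : C) (f g : T.forget.obj X → A), f ∈ maps X → g ∈ maps X → f + g ∈ maps X
  neg_mem : ∀ (X : C) (f : T.forget.obj X → A), f ∈ maps X → -f ∈ maps X
  act_mem : ∀ (X : C) (f : T.forget.obj X → A), f ∈ maps X →
    (fun z : T.forget.obj (G ⊗ X) =>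
      action (T.forget.map (fst G X) z) (f (T.forget.map (snd G X) z))) ∈ maps (G ⊗ X)

namespace RigidModule

variable {T : DiscreteObjects.{w} C}

section

variable {G : C} [MonObj G] {A : Type t} [AddCommGroup A] (M : T.RigidModule G A)

/-- The restriction of a rigidified module along a morphism of topologised monoids. -/
def restrict {H : C} [MonObj H] (i : H ⟶ G) [IsMonHom i] : T.RigidModule H A where
  toRigidification := M.toRigidification
  action := M.action.comp (T.mapHom i)
  zero_mem := M.zero_mem
  add_mem := M.add_mem
  neg_mem := M.neg_mem
  act_mem X f hf := by
    have h := M.comp_mem (i ▷ X) _ (M.act_mem X f hf)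
    convert h using 2 with z
    have h1 : T.forget.map (fst G X) (T.forget.map (i ▷ X) z) =
        T.forget.map i (T.forget.map (fst H X) z) := by
      rw [← Functor.map_comp_apply, ← Functor.map_comp_apply, whiskerRight_fst]
    have h2 : T.forget.map (snd G X) (T.forget.map (i ▷ X) z) = T.forget.map (snd H X) z := by
      rw [← Functor.map_comp_apply, whiskerRight_snd]
    rw [h1, h2]
    rfl

lemma action_mem [T.IsTopological] {X : C} (g : T.forget.obj G) (f : T.forget.obj X → A)
    (hf : f ∈ M.maps X) : (fun x => M.action g (f x)) ∈ M.maps X := by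
  have h := M.comp_mem (T.slice X g) _ (M.act_mem X f hf)
  simpa only [fst_slice, snd_slice] using h

/-- The inhomogeneous `n`-cochains of `G` with coefficients in `A`: the maps `Gⁿ → A` that are
admissible on the `n`-fold product `Gⁿ` in `C`. -/
def cochains (n : ℕ) : AddSubgroup ((Fin n → T.forget.obj G) → A) where
  carrier := {f | (fun z : T.forget.obj (∏ᶜ fun _ : Fin n => G) =>
    f fun i => T.forget.map (Pi.π (fun _ : Fin n => G) i) z) ∈ M.maps (∏ᶜ fun _ : Fin n => G)}
  zero_mem' := M.zero_mem _
  add_mem' hf hg := M.add_mem _ _ _ hf hg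
  neg_mem' hf := M.neg_mem _ _ hf

/-- The cohomology `Hⁿ(G, A)` of the topologised monoid `G` with coefficients in the rigidified
`G`-module `A`. -/
abbrev Cohomology (n : ℕ) : Type _ :=
  CochainCohomology M.action M.cochains n

end

section Product

variable [BraidedCategory C] (D G : C) [MonObj D] [MonObj G]

/-- The inclusion `d ↦ (d, 1)`. -/
abbrev inclLeft : D ⟶ D ⊗ G := lift (𝟙 D) (toUnit D ≫ η)

/-- The inclusion `g ↦ (1, g)`. -/
abbrev inclRight : G ⟶ D ⊗ G := lift (toUnit G ≫ η) (𝟙 G)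

variable {D G} in
lemma inclLeft_mul_inclRight (d : T.forget.obj D) (g : T.forget.obj G) :
    T.mapHom (inclLeft D G) d * T.mapHom (inclRight D G) g =
      T.mapHom (inclRight D G) g * T.mapHom (inclLeft D G) d := by
  have key : (T.elt D d ≫ inclLeft D G) * (T.elt G g ≫ inclRight D G) =
      (T.elt G g ≫ inclRight D G) * (T.elt D d ≫ inclLeft D G) := by
    apply CartesianMonoidalCategory.hom_ext
    · simp [MonObj.mul_comp, ← Hom.one_def]
    · simp [MonObj.mul_comp, ← Hom.one_def]
  apply (T.elt (D ⊗ G)).injective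
  rw [elt_mul, elt_mul]
  show T.elt _ (T.forget.map (inclLeft D G) d) * T.elt _ (T.forget.map (inclRight D G) g) =
    T.elt _ (T.forget.map (inclRight D G) g) * T.elt _ (T.forget.map (inclLeft D G) d)
  rw [elt_naturality, elt_naturality, key]

variable [T.IsTopological] {D G} {A : Type t} [AddCommGroup A] (M : T.RigidModule (D ⊗ G) A)

/-- `G`-cohomology of a rigidified `D × G`-module carries an action of `D`: the element `d` acts on
cochains by `(d f) (x) = d (f x)`. -/
def actionOnCohomology (n : ℕ) :
    T.forget.obj D →* AddMonoid.End ((M.restrict (inclRight D G)).Cohomology n) where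
  toFun d := cohomologyMap _ _ (M.action (T.mapHom (inclLeft D G) d))
    (fun g a => by
      show (M.action _ * M.action (T.mapHom (inclRight D G) g)) a =
        (M.action (T.mapHom (inclRight D G) g) * M.action _) a
      rw [← map_mul, ← map_mul, inclLeft_mul_inclRight])
    (fun _ _ hf => M.action_mem (T.mapHom (inclLeft D G) d) _ hf) n
  map_one' := by
    ext x
    induction x using QuotientAddGroup.induction_on with
    | H f =>
      refine congrArg (QuotientAddGroup.mk) (Subtype.ext (funext fun x => ?_))
      show M.action (T.mapHom (inclLeft D G) 1) (f.1 x) = f.1 x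
      simp
  map_mul' d e := by
    ext x
    induction x using QuotientAddGroup.induction_on with
    | H f =>
      refine congrArg (QuotientAddGroup.mk) (Subtype.ext (funext fun x => ?_))
      show M.action (T.mapHom (inclLeft D G) (d * e)) (f.1 x) =
        M.action (T.mapHom (inclLeft D G) d) (M.action (T.mapHom (inclLeft D G) e) (f.1 x))
      simp
end Product

end RigidModule

end DiscreteObjects

end

end TopMon

/-! By pliancy, an admissible function on $(D\times G)^n$ is an arbitrary function from $D^n$ to
$X^n(G,A)$ (`mem_cochains_iff`). Since $D$ acts trivially on $A$, the coboundary of $D\times G$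
turns into the diagonal differential of the bicosimplicial group
$Z^{m,n}=\mathrm{Map}(D^m,X^n(G,A))$, whose $D$-direction is untwisted (`coboundary_ofBicochain`).
The Eilenberg–Zilber theorem (`nonempty_diag_equiv_tot`) replaces the diagonal by the total complex,
which consists of the cochains on the nerve of $D$ with values in the complex $X^\bullet(G,A)$.

Only the quasi-isomorphism class of the coefficient complex matters, because $\mathrm{Map}(S,-)$ is
exact (`nonempty_cochains_equiv`). Quotients of divisible groups are divisible, so every abelian
group has an injective resolution of length one; therefore a complex of abelian groups is linked by
quasi-isomorphisms to its cohomology with zero differential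
(`nonempty_cochains_equiv_of_cohomology`). For that complex the total complex splits according to
$q$, and the summands compute $H^p(D,H^q(G,A))$ (`nonempty_cochains_equiv_directSum`).

For Eilenberg–Zilber, both complexes are compared with $E^{p,q}=Z([p]*[q],[q])$, where
$[p]*[q]=[p+q+1]$ is the join. The inclusion $[p]\to[p]*[q]$ gives a homotopy equivalence for each
fixed $p$ (`isQuasiIso_incl`). The inclusion $[q]\to[0]*[q]$ makes the complex $p\mapsto E^{p,q}$ a
resolution of $Z^{q,q}$ for each fixed $q$ (`isQuasiIso_diagToE`). In both cases the passage to
total complexes is the exactness of a double complex with exact rows (`exists_of_rows_exact`),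
applied to a mapping cone. -/

namespace TopMon

noncomputable section

/-! ### Subquotients -/

/-- A homomorphism that maps `Z₁` into `Z₂`, reflects and preserves membership in the subgroups
that are divided out, and is surjective modulo `B₂`, induces an isomorphism of subquotients. -/
theorem nonempty_subquotient_equiv {G₁ G₂ : Type*} [AddCommGroup G₁] [AddCommGroup G₂]
    {Z₁ B₁ : AddSubgroup G₁} {Z₂ B₂ : AddSubgroup G₂} (f : G₁ →+ G₂)
    (hZ : ∀ x ∈ Z₁, f x ∈ Z₂) (hB : ∀ x ∈ Z₁, f x ∈ B₂ ↔ x ∈ B₁)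
    (hs : ∀ y ∈ Z₂, ∃ x ∈ Z₁, y - f x ∈ B₂) :
    Nonempty ((Z₁ ⧸ B₁.addSubgroupOf Z₁) ≃+ (Z₂ ⧸ B₂.addSubgroupOf Z₂)) := by
  let g : Z₁ →+ Z₂ := (f.comp Z₁.subtype).codRestrict Z₂ fun x => hZ x x.2
  have hg : ∀ x : Z₁, (g x : G₂) = f x := fun _ => rfl
  let F : (Z₁ ⧸ B₁.addSubgroupOf Z₁) →+ (Z₂ ⧸ B₂.addSubgroupOf Z₂) :=
    QuotientAddGroup.map _ _ g fun x hx => (hB x x.2).2 hx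
  have hF : ∀ x : Z₁, F (QuotientAddGroup.mk x) = QuotientAddGroup.mk (g x) := fun _ => rfl
  refine ⟨AddEquiv.ofBijective F ⟨?_, ?_⟩⟩
  · rw [injective_iff_map_eq_zero]
    intro x hx
    induction x using QuotientAddGroup.induction_on with
    | H x =>
      rw [hF, QuotientAddGroup.eq_zero_iff] at hx
      rw [QuotientAddGroup.eq_zero_iff]
      exact (hB x x.2).1 hx
  · intro y
    induction y using QuotientAddGroup.induction_on with
    | H y =>
      obtain ⟨x, hx, h⟩ := hs y y.2
      refine ⟨QuotientAddGroup.mk ⟨x, hx⟩, ?_⟩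
      rw [hF, QuotientAddGroup.eq, AddSubgroup.mem_addSubgroupOf]
      simpa [hg, sub_eq_neg_add] using h

/-! ### Graded differential groups -/

/-- An abelian group `T` with a differential `d` of degree one, where the grading is given by the
projections to the homogeneous parts. -/
structure GradedDifferential (T : Type*) [AddCommGroup T] where
  /-- the differential -/
  d : T →+ T
  /-- the projection to the part of a given degree -/
  proj : ℕ → T →+ T
  d_d : ∀ x, d (d x) = 0
  proj_proj : ∀ n x, proj n (proj n x) = proj n x
  proj_zero_d : ∀ x, proj 0 (d x) = 0
  proj_succ_d : ∀ n x, proj (n + 1) (d x) = d (proj n x)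

namespace GradedDifferential

variable {T T' : Type*} [AddCommGroup T] [AddCommGroup T']

/-- The homogeneous cocycles of degree `n`. -/
def homogeneousCocycles (𝒯 : GradedDifferential T) (n : ℕ) : AddSubgroup T where
  carrier := {x | 𝒯.d x = 0 ∧ 𝒯.proj n x = x}
  zero_mem' := by simp
  add_mem' := by
    rintro a b ⟨ha, ha'⟩ ⟨hb, hb'⟩
    exact ⟨by rw [map_add, ha, hb, add_zero], by rw [map_add, ha', hb']⟩
  neg_mem' := by
    rintro a ⟨ha, ha'⟩
    exact ⟨by rw [map_neg, ha, neg_zero], by rw [map_neg, ha']⟩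

/-- The cohomology of a graded differential group. -/
abbrev H (𝒯 : GradedDifferential T) (n : ℕ) : Type _ :=
  𝒯.homogeneousCocycles n ⧸ (𝒯.d.range).addSubgroupOf (𝒯.homogeneousCocycles n)

/-- The map `f` is a quasi-isomorphism: its mapping cone is exact. -/
def IsQuasiIso (𝒯 : GradedDifferential T) (𝒯' : GradedDifferential T') (f : T →+ T') : Prop :=
  ∀ x' x, 𝒯'.d x' + f x = 0 → 𝒯.d x = 0 → ∃ y' y, x' = 𝒯'.d y' + f y ∧ x = -𝒯.d y

theorem IsQuasiIso.nonempty_equiv {𝒯 : GradedDifferential T} {𝒯' : GradedDifferential T'}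
    {f : T →+ T'} (hf : 𝒯.IsQuasiIso 𝒯' f) (hd : ∀ x, f (𝒯.d x) = 𝒯'.d (f x))
    (hp : ∀ n x, f (𝒯.proj n x) = 𝒯'.proj n (f x)) (n : ℕ) : Nonempty (𝒯.H n ≃+ 𝒯'.H n) := by
  refine nonempty_subquotient_equiv f ?_ ?_ ?_
  · rintro x ⟨h1, h2⟩
    exact ⟨by rw [← hd, h1, map_zero], by rw [← hp, h2]⟩
  · rintro x ⟨h1, h2⟩
    constructor
    -- If $f(x)=d y'$, then $(y',-x)$ is a cycle of the cone, and the second component of a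
    -- primitive exhibits $x$ as a boundary.
    · rintro ⟨y', hy'⟩
      obtain ⟨_, y, -, h⟩ := hf y' (-x) (by rw [hy', map_neg, add_neg_cancel])
        (by rw [map_neg, h1, neg_zero])
      exact ⟨y, (neg_injective h).symm⟩
    · rintro ⟨y, rfl⟩
      exact ⟨f y, (hd y).symm⟩
  · rintro x' ⟨h1, h2⟩
    -- The cone cycle $(x',0)$ has a primitive whose component `y` is a cocycle with image $x'$
    -- modulo boundaries. It need not be homogeneous, so its part of degree `n` is the preimage.
    obtain ⟨y', y, hy', hy⟩ := hf x' 0 (by rw [h1, map_zero, add_zero]) (map_zero _)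
    have hy : 𝒯.d y = 0 := by rw [← neg_eq_zero, ← hy]
    refine ⟨𝒯.proj n y, ⟨?_, 𝒯.proj_proj n y⟩, ?_⟩
    · rw [← 𝒯.proj_succ_d, hy, map_zero]
    · have : x' - f (𝒯.proj n y) = 𝒯'.proj n (𝒯'.d y') := by
        rw [← h2, hy', map_add, ← hp, add_sub_cancel_right]
      rw [this]
      cases n with
      | zero => rw [𝒯'.proj_zero_d]; exact zero_mem _
      | succ n => exact ⟨_, (𝒯'.proj_succ_d n y').symm⟩

/-- A bijective morphism is a quasi-isomorphism. -/
theorem isQuasiIso_of_bijective {𝒯 : GradedDifferential T} {𝒯' : GradedDifferential T'}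
    {f : T →+ T'} (hf : Function.Bijective f) (hd : ∀ x, f (𝒯.d x) = 𝒯'.d (f x)) :
    𝒯.IsQuasiIso 𝒯' f := by
  intro x' x h _
  obtain ⟨y, rfl⟩ := hf.2 x'
  refine ⟨0, y, by simp, hf.1 ?_⟩
  rw [map_neg, hd]
  exact eq_neg_of_add_eq_zero_right h

end GradedDifferential

/-! ### Sequences of groups -/

section Shift

variable {R R' : ℕ → Type*} [∀ p, AddCommGroup (R p)] [∀ p, AddCommGroup (R' p)]

/-- The endomorphism of the product of the groups `R p` given by homomorphisms of degree one. -/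
def shift (e : ∀ p, R p →+ R (p + 1)) : (∀ p, R p) →+ ∀ p, R p where
  toFun x p := match p with
    | 0 => 0
    | p + 1 => e p (x p)
  map_zero' := by
    funext p
    cases p <;> simp
  map_add' x y := by
    funext p
    cases p <;> simp

@[simp] lemma shift_zero (e : ∀ p, R p →+ R (p + 1)) (x : ∀ p, R p) : shift e x 0 = 0 := rfl

@[simp] lemma shift_succ (e : ∀ p, R p →+ R (p + 1)) (x : ∀ p, R p) (p : ℕ) :
    shift e x (p + 1) = e p (x p) := rfl

lemma shift_shift (e : ∀ p, R p →+ R (p + 1)) (he : ∀ p x, e (p + 1) (e p x) = 0) (x : ∀ p, R p) :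
    shift e (shift e x) = 0 := by
  funext p
  match p with
  | 0 => rfl
  | 1 => simp
  | p + 2 => simp [he]

/-- The projection to the factor with index `n`. -/
def component (R : ℕ → Type*) [∀ p, AddCommGroup (R p)] (n : ℕ) : (∀ p, R p) →+ ∀ p, R p where
  toFun x p := if p = n then x p else 0
  map_zero' := by
    funext p
    simp
  map_add' x y := by
    funext p
    by_cases h : p = n <;> simp [h]

lemma component_apply (n : ℕ) (x : ∀ p, R p) (p : ℕ) :
    component R n x p = if p = n then x p else 0 := rfl

lemma component_eq_self_iff {n : ℕ} {x : ∀ p, R p} :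
    component R n x = x ↔ ∀ p, p ≠ n → x p = 0 := by
  constructor
  · intro h p hp
    rw [← h, component_apply, if_neg hp]
  · intro h
    funext p
    rw [component_apply]
    split_ifs with hp
    · rfl
    · exact (h p hp).symm

/-- The graded differential group of a cochain complex. -/
def ofComplex (e : ∀ p, R p →+ R (p + 1)) (he : ∀ p x, e (p + 1) (e p x) = 0) :
    GradedDifferential (∀ p, R p) where
  d := shift e
  proj := component R
  d_d := shift_shift e he
  proj_proj n x := by
    funext p
    simp only [component_apply]
    split_ifs <;> rfl
  proj_zero_d x := by
    funext p
    rw [component_apply]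
    split_ifs with h
    · subst h; rfl
    · rfl
  proj_succ_d n x := by
    funext p
    cases p with
    | zero => rw [component_apply, shift_zero, shift_zero, ite_self]
    | succ p =>
      simp only [component_apply, shift_succ, Nat.add_right_cancel_iff]
      split_ifs <;> simp

/-- If the rows `(R p, d p)` of a double complex are exact, then so is the total complex. -/
theorem exists_of_rows_exact (d : ∀ p, R p →+ R p) (e : ∀ p, R p →+ R (p + 1))
    (hde : ∀ p x, d (p + 1) (e p x) = -e p (d p x)) (hee : ∀ p x, e (p + 1) (e p x) = 0)
    (hd : ∀ p x, d p x = 0 → ∃ y, d p y = x) (x : ∀ p, R p)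
    (hx : ∀ p, d p (x p) + shift e x p = 0) :
    ∃ y : ∀ p, R p, ∀ p, x p = d p (y p) + shift e y p := by
  have h0 : d 0 (x 0) = 0 := by simpa using hx 0
  obtain ⟨y₀, hy₀⟩ := hd 0 _ h0
  have h1 : d 1 (x 1 - e 0 y₀) = 0 := by
    rw [map_sub, hde, hy₀, sub_neg_eq_add]
    exact hx 1
  -- The equation with index `p + 1` is solvable only if the previous choice leaves a `d`-cycle on
  -- its right-hand side. The recursion therefore carries this condition along; anticommutativity
  -- and `hee` reproduce it.
  have step : ∀ p (y : {y : R p // d (p + 1) (x (p + 1) - e p y) = 0}),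
      ∃ z : {z : R (p + 1) // d (p + 2) (x (p + 2) - e (p + 1) z) = 0},
        d (p + 1) z.1 = x (p + 1) - e p y := by
    rintro p ⟨y, hy⟩
    obtain ⟨z, hz⟩ := hd _ _ hy
    refine ⟨⟨z, ?_⟩, hz⟩
    rw [map_sub, hde, hz, map_sub, hee, sub_zero, sub_neg_eq_add]
    exact hx (p + 2)
  choose s hs using step
  let y : ∀ p, {y : R p // d (p + 1) (x (p + 1) - e p y) = 0} :=
    fun p => Nat.rec ⟨y₀, h1⟩ (fun p z => s p z) p
  refine ⟨fun p => (y p).1, fun p => ?_⟩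
  cases p with
  | zero => exact (hy₀.symm.trans (add_zero _).symm)
  | succ p =>
    have : d (p + 1) (y (p + 1)).1 = x (p + 1) - e p (y p).1 := hs p (y p)
    rw [this, shift_succ, sub_add_cancel]

lemma shift_map {e : ∀ p, R p →+ R (p + 1)} {e' : ∀ p, R' p →+ R' (p + 1)} (f : ∀ p, R p →+ R' p)
    (hf : ∀ p x, f (p + 1) (e p x) = e' p (f p x)) (x : ∀ p, R p) (p : ℕ) :
    f p (shift e x p) = shift e' (fun p => f p (x p)) p := by
  cases p with
  | zero => simp
  | succ p => simp [hf]

/-- The total complex of a double complex that is given by its rows. -/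
def total (𝒢 : ∀ p, GradedDifferential (R p)) (e : ∀ p, R p →+ R (p + 1))
    (hd : ∀ p x, (𝒢 (p + 1)).d (e p x) = e p ((𝒢 p).d x))
    (hp : ∀ n p x, (𝒢 (p + 1)).proj n (e p x) = e p ((𝒢 p).proj n x))
    (hee : ∀ p x, e (p + 1) (e p x) = 0) : GradedDifferential (∀ p, R p) where
  d := AddMonoidHom.mk' (fun x p => (-1 : ℤ) ^ p • (𝒢 p).d (x p) + shift e x p) fun x y => by
    funext p
    simp only [Pi.add_apply, map_add, smul_add]
    abel
  proj n := AddMonoidHom.mk' (fun x p => if p ≤ n then (𝒢 p).proj (n - p) (x p) else 0)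
    fun x y => by
      funext p
      simp only [Pi.add_apply, map_add]
      split_ifs <;> simp
  d_d x := by
    funext p
    cases p with
    | zero => simp [(𝒢 0).d_d]
    | succ p =>
      have h : shift e (fun p => (-1 : ℤ) ^ p • (𝒢 p).d (x p) + shift e x p) (p + 1) =
          (-1 : ℤ) ^ p • e p ((𝒢 p).d (x p)) + shift e (shift e x) (p + 1) := by
        rw [shift_succ, map_add, map_zsmul, shift_succ]
      simp only [AddMonoidHom.mk'_apply, h, shift_shift e hee]
      simp [(𝒢 _).d_d, hd, pow_succ]
  proj_proj n x := by
    funext p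
    simp only [AddMonoidHom.mk'_apply]
    split_ifs
    · exact (𝒢 p).proj_proj _ _
    · rfl
  proj_zero_d x := by
    funext p
    simp only [AddMonoidHom.mk'_apply]
    split_ifs with h
    · obtain rfl : p = 0 := by omega
      simp [(𝒢 0).proj_zero_d]
    · rfl
  proj_succ_d n x := by
    funext p
    simp only [AddMonoidHom.mk'_apply]
    cases p with
    | zero => simp [(𝒢 0).proj_succ_d]
    | succ p =>
      simp only [map_add, map_zsmul, shift_succ, Nat.add_le_add_iff_right, Nat.add_sub_add_right,
        hp]
      by_cases h : p + 1 ≤ n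
      · have h2 : n - p = n - (p + 1) + 1 := by omega
        have h3 : p ≤ n := by omega
        simp only [if_pos h, if_pos h3, h2, (𝒢 (p + 1)).proj_succ_d]
      · by_cases h3 : p ≤ n
        · obtain rfl : p = n := by omega
          simp [(𝒢 (p + 1)).proj_zero_d]
        · simp [h, h3]

variable {𝒢 : ∀ p, GradedDifferential (R p)} {e : ∀ p, R p →+ R (p + 1)}
  {hd : ∀ p x, (𝒢 (p + 1)).d (e p x) = e p ((𝒢 p).d x)}
  {hp : ∀ n p x, (𝒢 (p + 1)).proj n (e p x) = e p ((𝒢 p).proj n x)}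
  {hee : ∀ p x, e (p + 1) (e p x) = 0}
  {𝒢' : ∀ p, GradedDifferential (R' p)} {e' : ∀ p, R' p →+ R' (p + 1)}
  {hd' : ∀ p x, (𝒢' (p + 1)).d (e' p x) = e' p ((𝒢' p).d x)}
  {hp' : ∀ n p x, (𝒢' (p + 1)).proj n (e' p x) = e' p ((𝒢' p).proj n x)}
  {hee' : ∀ p x, e' (p + 1) (e' p x) = 0}

lemma total_d_apply (x : ∀ p, R p) (p : ℕ) :
    (total 𝒢 e hd hp hee).d x p = (-1 : ℤ) ^ p • (𝒢 p).d (x p) + shift e x p := rfl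

lemma total_proj_apply (n : ℕ) (x : ∀ p, R p) (p : ℕ) :
    (total 𝒢 e hd hp hee).proj n x p = if p ≤ n then (𝒢 p).proj (n - p) (x p) else 0 := rfl

/-- The map of total complexes given by maps of the rows. -/
def totalMap (f : ∀ p, R p →+ R' p) : (∀ p, R p) →+ ∀ p, R' p :=
  AddMonoidHom.mk' (fun x p => f p (x p)) fun x y => by
    funext p
    simp

lemma totalMap_apply (f : ∀ p, R p →+ R' p) (x : ∀ p, R p) (p : ℕ) :
    totalMap f x p = f p (x p) := rfl

/-- A map of double complexes that is a quasi-isomorphism on every row is a quasi-isomorphism of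
the total complexes. -/
theorem isQuasiIso_totalMap (f : ∀ p, R p →+ R' p)
    (hfe : ∀ p x, f (p + 1) (e p x) = e' p (f p x))
    (hf : ∀ p, (𝒢 p).IsQuasiIso (𝒢' p) (f p)) :
    (total 𝒢 e hd hp hee).IsQuasiIso (total 𝒢' e' hd' hp' hee') (totalMap f) := by
  intro x' x h1 h2
  -- The cone of the total map is itself the total complex of a double complex whose row `p` is, up
  -- to signs, the cone of `f p`. The minus signs in the second component are those of the cone
  -- differential.
  let dC : ∀ p, R' p × R p →+ R' p × R p := fun p =>
    AddMonoidHom.mk' (fun z =>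
        ((-1 : ℤ) ^ p • (𝒢' p).d z.1 + f p z.2, -((-1 : ℤ) ^ p • (𝒢 p).d z.2)))
      fun a b => by
        ext <;> simp only [Prod.fst_add, Prod.snd_add, map_add, smul_add] <;> abel
  let eC : ∀ p, R' p × R p →+ R' (p + 1) × R (p + 1) := fun p =>
    AddMonoidHom.mk' (fun z => (e' p z.1, -e p z.2)) fun a b => by
      ext
      · simp
      · simp only [Prod.snd_add, map_add]; abel
  have hs : ∀ (z' : ∀ p, R' p) (z : ∀ p, R p) (p : ℕ),
      shift eC (fun p => (z' p, z p)) p = (shift e' z' p, -shift e z p) := by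
    intro z' z p
    cases p with
    | zero => exact Prod.ext rfl neg_zero.symm
    | succ p => rfl
  have hsgn : ∀ p : ℕ, (-1 : ℤ) ^ p * (-1 : ℤ) ^ p = 1 := fun p => by
    rw [← mul_pow]; simp
  have hanti : ∀ p z, dC (p + 1) (eC p z) = -eC p (dC p z) := by
    rintro p ⟨z', z⟩
    have hpow : (-1 : ℤ) ^ (p + 1) = -(-1 : ℤ) ^ p := by ring
    simp only [dC, eC, AddMonoidHom.mk'_apply, Prod.neg_mk, map_add, map_neg, map_zsmul, hd, hd',
      hfe, hpow]
    generalize (-1 : ℤ) ^ p = c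
    ext
    · simp only [neg_smul]
      abel
    · simp only [neg_smul, smul_neg]
  have hsq : ∀ p z, eC (p + 1) (eC p z) = 0 := by
    rintro p ⟨z', z⟩
    simp [eC, hee, hee']
  have hrow : ∀ p z, dC p z = 0 → ∃ y, dC p y = z := by
    rintro p ⟨z', z⟩ h
    have h1 : (-1 : ℤ) ^ p • (𝒢' p).d z' + f p z = 0 := congrArg Prod.fst h
    have h2 : -((-1 : ℤ) ^ p • (𝒢 p).d z) = 0 := congrArg Prod.snd h
    -- Multiplying by $(-1)^p$ moves the sign from the differential to the second component, so that
    -- the hypothesis on the row applies.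
    obtain ⟨y', y, hy', hy⟩ := hf p z' ((-1 : ℤ) ^ p • z) (by
        rw [map_zsmul]
        have := congrArg (fun a => (-1 : ℤ) ^ p • a) h1
        simpa only [smul_add, smul_smul, hsgn, one_smul, smul_zero] using this)
      (by rw [map_zsmul]; exact neg_eq_zero.1 h2)
    refine ⟨((-1 : ℤ) ^ p • y', y), Prod.ext ?_ ?_⟩
    · simp only [dC, AddMonoidHom.mk'_apply, map_zsmul, smul_smul, hsgn, one_smul, hy']
    · simp only [dC, AddMonoidHom.mk'_apply]
      rw [← smul_neg, ← hy, smul_smul, hsgn, one_smul]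
  have hx : ∀ p, dC p (x' p, x p) + shift eC (fun p => (x' p, x p)) p = 0 := by
    intro p
    rw [hs]
    refine Prod.ext ?_ ?_
    · have := congrFun h1 p
      rw [Pi.add_apply, total_d_apply, totalMap_apply, Pi.zero_apply] at this
      simp only [dC, AddMonoidHom.mk'_apply, Prod.fst_add, Prod.fst_zero]
      rw [← this]
      abel
    · have := congrFun h2 p
      rw [total_d_apply] at this
      simp only [dC, AddMonoidHom.mk'_apply, Prod.snd_add]
      rw [← neg_add, this]
      simp
  obtain ⟨y, hy⟩ := exists_of_rows_exact dC eC hanti hsq hrow (fun p => (x' p, x p)) hx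
  refine ⟨fun p => (y p).1, fun p => (y p).2, ?_, ?_⟩
  · funext p
    have h := congrArg Prod.fst (hy p)
    rw [show y = fun p => ((y p).1, (y p).2) from rfl, hs] at h
    rw [Pi.add_apply, total_d_apply, totalMap_apply]
    refine h.trans ?_
    simp only [dC, AddMonoidHom.mk'_apply, Prod.fst_add]
    abel
  · funext p
    have h := congrArg Prod.snd (hy p)
    rw [show y = fun p => ((y p).1, (y p).2) from rfl, hs] at h
    rw [Pi.neg_apply, total_d_apply]
    refine h.trans ?_
    simp only [dC, AddMonoidHom.mk'_apply, Prod.snd_add]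
    abel

end Shift

/-! ### Divisible groups -/

/-- Homomorphisms to divisible groups extend along homomorphisms whose kernel they vanish on. -/
theorem exists_extension_of_divisible {X Y Q : Type*} [AddCommGroup X] [AddCommGroup Y]
    [AddCommGroup Q] [DivisibleBy Q ℤ] (φ : X →+ Y) (ψ : X →+ Q) (h : ∀ x, φ x = 0 → ψ x = 0) :
    ∃ β : Y →+ Q, ∀ x, β (φ x) = ψ x := by
  obtain ⟨β, hβ⟩ := (Module.Baer.of_divisible Q).extension_property_addMonoidHom
    (QuotientAddGroup.kerLift φ) (QuotientAddGroup.kerLift_injective φ)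
    (QuotientAddGroup.lift φ.ker ψ fun x hx => h x hx)
  exact ⟨β, fun x => DFunLike.congr_fun hβ (QuotientAddGroup.mk x)⟩

/-- A divisible group that contains the abelian group `B`. -/
abbrev DivisibleHull (B : Type*) [AddCommGroup B] : Type _ :=
  CharacterModule B → AddCircle (1 : ℚ)

/-- The embedding of an abelian group into a divisible group. -/
def toDivisibleHull (B : Type*) [AddCommGroup B] : B →+ DivisibleHull B :=
  AddMonoidHom.mk' (fun b c => c b) fun x y => by
    funext c
    simp

/-- Characters with values in $\mathbb{Q}/\mathbb{Z}$ separate the elements of an abelian group. -/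
lemma toDivisibleHull_injective (B : Type*) [AddCommGroup B] :
    Function.Injective (toDivisibleHull B) :=
  (injective_iff_map_eq_zero _).2 fun _ h =>
    CharacterModule.eq_zero_of_character_apply fun c => congrFun h c

instance (B : Type*) [AddCommGroup B] (N : AddSubgroup (DivisibleHull B)) :
    DivisibleBy (DivisibleHull B ⧸ N) ℤ :=
  letI : DivisibleBy (DivisibleHull B) ℕ := AddGroup.divisibleByNatOfDivisibleByInt _
  AddGroup.divisibleByIntOfDivisibleByNat _

/-! ### Alternating sums -/

section AltSum

variable {A A' B B' : Type*} [AddCommGroup A] [AddCommGroup A'] [AddCommGroup B] [AddCommGroup B']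

/-- The alternating sum of the first `N` members of a sequence of homomorphisms. -/
def altSum (N : ℕ) (f : ℕ → A →+ B) : A →+ B := ∑ i ∈ Finset.range N, (-1 : ℤ) ^ i • f i

lemma altSum_apply (N : ℕ) (f : ℕ → A →+ B) (x : A) :
    altSum N f x = ∑ i ∈ Finset.range N, (-1 : ℤ) ^ i • f i x := by
  simp [altSum]

lemma map_altSum (N : ℕ) {f : ℕ → A →+ B} {f' : ℕ → A' →+ B'} (g : B →+ B') (x : A) (x' : A')
    (h : ∀ i < N, g (f i x) = f' i x') : g (altSum N f x) = altSum N f' x' := by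
  simp only [altSum_apply, map_sum, map_zsmul]
  exact Finset.sum_congr rfl fun i hi => by rw [h i (Finset.mem_range.1 hi)]

lemma altSum_altSum {C : Type*} [AddCommGroup C] (N N' : ℕ) (f : ℕ → A →+ B) (g : ℕ → B →+ C)
    (x : A) : altSum N' g (altSum N f x) =
      ∑ j ∈ Finset.range N', ∑ i ∈ Finset.range N, (-1 : ℤ) ^ (i + j) • g j (f i x) := by
  rw [altSum_apply]
  refine Finset.sum_congr rfl fun j _ => ?_
  rw [altSum_apply, map_sum, Finset.smul_sum]
  exact Finset.sum_congr rfl fun i _ => by rw [map_zsmul, smul_smul, pow_add, mul_comm]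

/-- For $i\le j$ the terms with indices $(j+1,i)$ and $(i,j)$ agree and have opposite signs, so
everything cancels in pairs. This is the source of all the relations $d^2=0$ below. -/
lemma sum_cosimplicial_eq_zero (N : ℕ) (c : ℕ → ℕ → A)
    (h : ∀ i j, i ≤ j → j ≤ N → c (j + 1) i = c i j) :
    ∑ j ∈ Finset.range (N + 2), ∑ i ∈ Finset.range (N + 1), (-1 : ℤ) ^ (i + j) • c j i = 0 := by
  induction N with
  | zero => simp [Finset.sum_range_succ, h 0 0 le_rfl le_rfl]
  | succ N ih =>
    rw [Finset.sum_range_succ]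
    simp_rw [fun j => Finset.sum_range_succ (fun i => (-1 : ℤ) ^ (i + j) • c j i) (N + 1)]
    rw [Finset.sum_add_distrib, ih fun i j hi hj => h i j hi (by omega), zero_add]
    rw [← Finset.sum_range_succ (fun i => (-1 : ℤ) ^ (i + (N + 1 + 1)) • c (N + 1 + 1) i),
      ← Finset.sum_add_distrib]
    refine Finset.sum_eq_zero fun i hi => ?_
    have hi := Finset.mem_range.1 hi
    rw [h i (N + 1) (by omega) le_rfl, ← add_smul]
    have : (-1 : ℤ) ^ (N + 1 + i) + (-1) ^ (i + (N + 1 + 1)) = 0 := by ring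
    rw [this, zero_smul]

/-- Sign bookkeeping for a cosimplicial homotopy: `a i j` plays the role of $h_i d_j$ and `b j i`
that of $d_j h_i$. The first two relations cancel the second sum, the third makes the remaining
diagonal terms telescope, and only the two extreme terms survive. -/
lemma sum_homotopy (q : ℕ) (a b : ℕ → ℕ → A)
    (h1 : ∀ i j, j ≤ i → i < q → a (i + 1) j = b j i)
    (h2 : ∀ i j, i < j → j ≤ q → a i (j + 1) = b j i)
    (h3 : ∀ i, i < q → a (i + 1) (i + 1) = a i (i + 1)) :
    ∑ i ∈ Finset.range (q + 1), ∑ j ∈ Finset.range (q + 2), (-1 : ℤ) ^ (j + i) • a i j +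
      ∑ j ∈ Finset.range (q + 1), ∑ i ∈ Finset.range q, (-1 : ℤ) ^ (i + j) • b j i =
      a 0 0 - a q (q + 1) := by
  induction q with
  | zero => simp [Finset.sum_range_succ, sub_eq_add_neg]
  | succ q ih =>
    have ih := ih (fun i j hi hj => h1 i j hi (by omega)) (fun i j hi hj => h2 i j hi (by omega))
      (fun i hi => h3 i (by omega))
    have e1 : ∑ i ∈ Finset.range (q + 1 + 1), ∑ j ∈ Finset.range (q + 1 + 2),
        (-1 : ℤ) ^ (j + i) • a i j =
        (∑ i ∈ Finset.range (q + 1), ∑ j ∈ Finset.range (q + 2), (-1 : ℤ) ^ (j + i) • a i j) +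
        (∑ i ∈ Finset.range (q + 1), (-1 : ℤ) ^ (q + i) • a i (q + 2)) +
        ((∑ j ∈ Finset.range (q + 1), -((-1 : ℤ) ^ (q + j) • a (q + 1) j)) +
          a (q + 1) (q + 1) - a (q + 1) (q + 2)) := by
      rw [Finset.sum_range_succ]
      simp_rw [fun i => Finset.sum_range_succ (fun j => (-1 : ℤ) ^ (j + i) • a i j) (q + 2)]
      rw [Finset.sum_add_distrib, Finset.sum_range_succ _ (q + 1)]
      have s1 : (-1 : ℤ) ^ (q + 1 + (q + 1)) = 1 := Even.neg_one_pow ⟨_, rfl⟩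
      have s2 : (-1 : ℤ) ^ (q + 2 + (q + 1)) = -1 := Odd.neg_one_pow ⟨q + 1, by ring⟩
      have s3 : ∀ i, (-1 : ℤ) ^ (q + 2 + i) = (-1) ^ (q + i) := fun i => by ring
      have s4 : ∀ j, (-1 : ℤ) ^ (j + (q + 1)) = -(-1) ^ (q + j) := fun i => by ring
      rw [s1, s2]
      simp only [s3, s4, neg_smul, one_smul]
      abel
    have e2 : ∑ j ∈ Finset.range (q + 1 + 1), ∑ i ∈ Finset.range (q + 1),
        (-1 : ℤ) ^ (i + j) • b j i =
        (∑ j ∈ Finset.range (q + 1), ∑ i ∈ Finset.range q, (-1 : ℤ) ^ (i + j) • b j i) +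
        (∑ j ∈ Finset.range (q + 1), (-1 : ℤ) ^ (q + j) • b j q) +
        (∑ i ∈ Finset.range (q + 1), -((-1 : ℤ) ^ (q + i) • b (q + 1) i)) := by
      rw [Finset.sum_range_succ]
      simp_rw [fun j => Finset.sum_range_succ (fun i => (-1 : ℤ) ^ (i + j) • b j i) q]
      have s4 : ∀ j, (-1 : ℤ) ^ (j + (q + 1)) = -(-1) ^ (q + j) := fun i => by ring
      simp only [s4, neg_smul, Finset.sum_add_distrib]
      rw [Finset.sum_range_succ (fun i => -((-1 : ℤ) ^ (q + i) • b (q + 1) i)) q]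
    have e3 : ∑ i ∈ Finset.range (q + 1), (-1 : ℤ) ^ (q + i) • a i (q + 2) =
        ∑ i ∈ Finset.range (q + 1), (-1 : ℤ) ^ (q + i) • b (q + 1) i :=
      Finset.sum_congr rfl fun i hi => by
        rw [h2 i (q + 1) (by have := Finset.mem_range.1 hi; omega) le_rfl]
    have e4 : ∑ j ∈ Finset.range (q + 1), (-1 : ℤ) ^ (q + j) • a (q + 1) j =
        ∑ j ∈ Finset.range (q + 1), (-1 : ℤ) ^ (q + j) • b j q :=
      Finset.sum_congr rfl fun j hj => by
        rw [h1 q j (by have := Finset.mem_range.1 hj; omega) (by omega)]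
    rw [e1, e2]
    simp only [Finset.sum_neg_distrib]
    rw [e3, e4, h3 q (by omega)]
    rw [← sub_eq_zero] at ih ⊢
    rw [← ih]
    abel

end AltSum

/-! ### Bicosimplicial groups -/

/-- The function `α` restricts to a monotone map `{0, …, m} → {0, …, m'}`. -/
structure IsSimplexMap (m m' : ℕ) (α : ℕ → ℕ) : Prop where
  mono : ∀ i j, i ≤ j → j ≤ m → α i ≤ α j
  le : ∀ i, i ≤ m → α i ≤ m'

/-- The coface map that omits the value `i`. -/
def coface (i k : ℕ) : ℕ := if k < i then k else k + 1

/-- The codegeneracy map that takes the value `i` twice. -/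
def codegeneracy (i k : ℕ) : ℕ := if k ≤ i then k else k - 1

/-- The map from the join of `{0, …, p}` and `{0, …, q + 1}` to the join of `{0, …, p}` and
`{0, …, q}` that maps the elements `k ≤ i` of the second summand to `p`, and the others to
`k - 1`. -/
def prism (p i k : ℕ) : ℕ := if k ≤ p then k else if k ≤ p + 1 + i then p else k - 1

lemma isSimplexMap_id {m m' : ℕ} (h : m ≤ m') : IsSimplexMap m m' id :=
  ⟨fun _ _ h _ => h, fun _ hi => hi.trans h⟩

lemma isSimplexMap_coface {m m' : ℕ} (i : ℕ) (h : m + 1 ≤ m') : IsSimplexMap m m' (coface i) := by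
  constructor <;> intros <;> simp only [coface] <;> split_ifs <;> omega

lemma isSimplexMap_codegeneracy {m m' : ℕ} (i : ℕ) (h : m ≤ m' + 1) (hi : i ≤ m') :
    IsSimplexMap m m' (codegeneracy i) := by
  constructor <;> intros <;> simp only [codegeneracy] <;> split_ifs <;> omega

lemma isSimplexMap_prism {m m' : ℕ} (p i : ℕ) (h : m ≤ m' + 1) (hp : p ≤ m') :
    IsSimplexMap m m' (prism p i) := by
  constructor <;> intros <;> simp only [prism] <;> split_ifs <;> omega

lemma isSimplexMap_min {m p : ℕ} : IsSimplexMap m p (min p) :=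
  ⟨fun _ _ h _ => min_le_min_left _ h, fun _ _ => min_le_left _ _⟩

/-- The structure of a bicosimplicial abelian group on a family of abelian groups. -/
structure Bicosimplicial (Z : ℕ → ℕ → Type*) [∀ m n, AddCommGroup (Z m n)] where
  /-- the functoriality; only the restrictions to `{0, …, m}` and `{0, …, n}` are relevant -/
  map : ∀ {m n m' n' : ℕ}, (ℕ → ℕ) → (ℕ → ℕ) → Z m n →+ Z m' n'
  map_eq_self : ∀ {m n : ℕ} (α β : ℕ → ℕ) (z : Z m n), (∀ k ≤ m, α k = k) → (∀ k ≤ n, β k = k) →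
    (map α β z : Z m n) = z
  map_map : ∀ {m n m' n' m'' n'' : ℕ} {α α' α'' β β' β'' : ℕ → ℕ} (z : Z m n),
    IsSimplexMap m m' α → IsSimplexMap m' m'' α' → IsSimplexMap n n' β → IsSimplexMap n' n'' β' →
    (∀ k ≤ m, α' (α k) = α'' k) → (∀ k ≤ n, β' (β k) = β'' k) →
    (map α' β' (map α β z : Z m' n') : Z m'' n'') = map α'' β'' z

namespace Bicosimplicial

variable {Z : ℕ → ℕ → Type*} [∀ m n, AddCommGroup (Z m n)] (𝒵 : Bicosimplicial Z)

/-- The intermediate bidegrees on the two sides are independent. Hence a cosimplicial identity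
reduces to an arithmetic identity on indices, without transport between groups whose indices are
equal only propositionally. -/
lemma map_comm {m n m₁ n₁ m₂ n₂ m' n' : ℕ} {α₁ α₁' α₂ α₂' β₁ β₁' β₂ β₂' : ℕ → ℕ} (z : Z m n)
    (h1 : IsSimplexMap m m₁ α₁) (h1' : IsSimplexMap m₁ m' α₁')
    (h2 : IsSimplexMap n n₁ β₁) (h2' : IsSimplexMap n₁ n' β₁')
    (h3 : IsSimplexMap m m₂ α₂) (h3' : IsSimplexMap m₂ m' α₂')
    (h4 : IsSimplexMap n n₂ β₂) (h4' : IsSimplexMap n₂ n' β₂')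
    (ha : ∀ k ≤ m, α₁' (α₁ k) = α₂' (α₂ k)) (hb : ∀ k ≤ n, β₁' (β₁ k) = β₂' (β₂ k)) :
    (𝒵.map α₁' β₁' (𝒵.map α₁ β₁ z : Z m₁ n₁) : Z m' n') =
      𝒵.map α₂' β₂' (𝒵.map α₂ β₂ z : Z m₂ n₂) := by
  rw [𝒵.map_map (α'' := α₂' ∘ α₂) (β'' := β₂' ∘ β₂) z h1 h1' h2 h2' ha hb,
    𝒵.map_map z h3 h3' h4 h4' (fun _ _ => rfl) fun _ _ => rfl]
  rfl

lemma map_map_eq_self {m n m' n' : ℕ} {α α' β β' : ℕ → ℕ} (z : Z m n)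
    (h1 : IsSimplexMap m m' α) (h1' : IsSimplexMap m' m α')
    (h2 : IsSimplexMap n n' β) (h2' : IsSimplexMap n' n β')
    (ha : ∀ k ≤ m, α' (α k) = k) (hb : ∀ k ≤ n, β' (β k) = k) :
    𝒵.map α' β' (𝒵.map α β z : Z m' n') = z := by
  rw [𝒵.map_map (α'' := id) (β'' := id) z h1 h1' h2 h2' ha hb,
    𝒵.map_eq_self id id z (fun _ _ => rfl) fun _ _ => rfl]

/-- The differential of the diagonal complex. -/
def diagD (n : ℕ) : Z n n →+ Z (n + 1) (n + 1) :=
  altSum (n + 2) fun i => 𝒵.map (coface i) (coface i)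

/-- The horizontal differential. -/
def horD (p q : ℕ) : Z p q →+ Z (p + 1) q :=
  altSum (p + 2) fun i => 𝒵.map (coface i) id

/-- The vertical differential. -/
def verD (p q : ℕ) : Z p q →+ Z p (q + 1) :=
  altSum (q + 2) fun j => 𝒵.map id (coface j)

/-- The horizontal differential on the groups `Z (p + q + 1) q`. -/
def horE (p q : ℕ) : Z (p + q + 1) q →+ Z (p + 1 + q + 1) q :=
  altSum (p + 2) fun i => 𝒵.map (coface i) id

/-- The vertical differential on the groups `Z (p + q + 1) q`. -/
def verE (p q : ℕ) : Z (p + q + 1) q →+ Z (p + (q + 1) + 1) (q + 1) :=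
  altSum (q + 2) fun j => 𝒵.map (coface (p + 1 + j)) (coface j)

lemma diagD_diagD (n : ℕ) (z : Z n n) : 𝒵.diagD (n + 1) (𝒵.diagD n z) = 0 := by
  rw [diagD, diagD, altSum_altSum]
  refine sum_cosimplicial_eq_zero (n + 1) _ fun i j hij hj =>
      𝒵.map_comm z ?_ ?_ ?_ ?_ ?_ ?_ ?_ ?_ ?_ ?_
  all_goals first
    | exact isSimplexMap_coface _ (by omega)
    | (intro k hk; simp only [coface]; split_ifs <;> omega)

lemma horD_horD (p q : ℕ) (z : Z p q) : 𝒵.horD (p + 1) q (𝒵.horD p q z) = 0 := by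
  rw [horD, horD, altSum_altSum]
  refine sum_cosimplicial_eq_zero (p + 1) _ fun i j hij hj =>
      𝒵.map_comm z ?_ ?_ ?_ ?_ ?_ ?_ ?_ ?_ ?_ ?_
  all_goals first
    | exact isSimplexMap_coface _ (by omega)
    | exact isSimplexMap_id (by omega)
    | (intro k hk; simp only [coface]; split_ifs <;> omega)
    | (intro k hk; rfl)

lemma verD_verD (p q : ℕ) (z : Z p q) : 𝒵.verD p (q + 1) (𝒵.verD p q z) = 0 := by
  rw [verD, verD, altSum_altSum]
  refine sum_cosimplicial_eq_zero (q + 1) _ fun i j hij hj =>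
      𝒵.map_comm z ?_ ?_ ?_ ?_ ?_ ?_ ?_ ?_ ?_ ?_
  all_goals first
    | exact isSimplexMap_coface _ (by omega)
    | exact isSimplexMap_id (by omega)
    | (intro k hk; rfl)
    | (intro k hk; simp only [coface]; split_ifs <;> omega)

lemma verD_horD (p q : ℕ) (z : Z p q) :
    𝒵.verD (p + 1) q (𝒵.horD p q z) = 𝒵.horD p (q + 1) (𝒵.verD p q z) := by
  refine map_altSum _ _ _ _ fun i hi => (map_altSum _ _ _ _ fun j hj =>
      𝒵.map_comm z ?_ ?_ ?_ ?_ ?_ ?_ ?_ ?_ ?_ ?_).symm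
  all_goals first
    | exact isSimplexMap_coface _ (by omega)
    | exact isSimplexMap_id (by omega)
    | (intro k hk; rfl)

lemma horE_horE (p q : ℕ) (z : Z (p + q + 1) q) : 𝒵.horE (p + 1) q (𝒵.horE p q z) = 0 := by
  rw [horE, horE, altSum_altSum]
  refine sum_cosimplicial_eq_zero (p + 1) _ fun i j hij hj =>
      𝒵.map_comm z ?_ ?_ ?_ ?_ ?_ ?_ ?_ ?_ ?_ ?_
  all_goals first
    | exact isSimplexMap_coface _ (by omega)
    | exact isSimplexMap_id (by omega)
    | (intro k hk; simp only [coface]; split_ifs <;> omega)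
    | (intro k hk; rfl)

lemma verE_verE (p q : ℕ) (z : Z (p + q + 1) q) : 𝒵.verE p (q + 1) (𝒵.verE p q z) = 0 := by
  rw [verE, verE, altSum_altSum]
  refine sum_cosimplicial_eq_zero (q + 1) _ fun i j hij hj =>
      𝒵.map_comm z ?_ ?_ ?_ ?_ ?_ ?_ ?_ ?_ ?_ ?_
  all_goals first
    | exact isSimplexMap_coface _ (by omega)
    | (intro k hk; simp only [coface]; split_ifs <;> omega)

lemma verE_horE (p q : ℕ) (z : Z (p + q + 1) q) :
    𝒵.verE (p + 1) q (𝒵.horE p q z) = 𝒵.horE p (q + 1) (𝒵.verE p q z) := by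
  refine map_altSum _ _ _ _ fun i hi => (map_altSum _ _ _ _ fun j hj =>
      𝒵.map_comm z ?_ ?_ ?_ ?_ ?_ ?_ ?_ ?_ ?_ ?_).symm
  all_goals first
    | exact isSimplexMap_coface _ (by omega)
    | exact isSimplexMap_id (by omega)
    | (intro k hk; simp only [coface]; split_ifs <;> omega)
    | (intro k hk; rfl)

/-! ### The theorem of Eilenberg and Zilber -/

/-- The total complex of a bicosimplicial group. -/
def tot : GradedDifferential (∀ p q, Z p q) :=
  total (fun p => ofComplex (𝒵.verD p) (𝒵.verD_verD p))
    (fun p => totalMap fun q => 𝒵.horD p q)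
    (fun p x => funext fun q => (shift_map (fun q => 𝒵.horD p q)
      (fun q z => (𝒵.verD_horD p q z).symm) x q).symm)
    (fun n p x => funext fun q => by
      simp only [ofComplex, component_apply, totalMap_apply]
      split_ifs <;> simp)
    (fun p x => funext fun q => 𝒵.horD_horD p q (x q))

/-- The total complex of the groups `Z (p + q + 1) q`. -/
def totE : GradedDifferential (∀ p q, Z (p + q + 1) q) :=
  total (fun p => ofComplex (𝒵.verE p) (𝒵.verE_verE p))
    (fun p => totalMap fun q => 𝒵.horE p q)
    (fun p x => funext fun q => (shift_map (fun q => 𝒵.horE p q)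
      (fun q z => (𝒵.verE_horE p q z).symm) x q).symm)
    (fun n p x => funext fun q => by
      simp only [ofComplex, component_apply, totalMap_apply]
      split_ifs <;> simp)
    (fun p x => funext fun q => 𝒵.horE_horE p q (x q))

/-- The map induced by the inclusion of `{0, …, p}` into its join with `{0, …, q}`. -/
def incl (p q : ℕ) : Z p q →+ Z (p + q + 1) q := 𝒵.map id id

/-- The map induced by the retraction of the join of `{0, …, p}` and `{0, …, q}`. -/
def retr (p q : ℕ) : Z (p + q + 1) q →+ Z p q := 𝒵.map (min p) id

/-- The homotopy between the identity and `incl ∘ retr`. -/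
def homotopy (p q : ℕ) : Z (p + (q + 1) + 1) (q + 1) →+ Z (p + q + 1) q :=
  altSum (q + 1) fun i => 𝒵.map (prism p i) (codegeneracy i)

lemma incl_horD (p q : ℕ) (z : Z p q) :
    𝒵.incl (p + 1) q (𝒵.horD p q z) = 𝒵.horE p q (𝒵.incl p q z) := by
  refine map_altSum _ _ _ _ fun i hi => 𝒵.map_comm z ?_ ?_ ?_ ?_ ?_ ?_ ?_ ?_ ?_ ?_
  all_goals first
    | exact isSimplexMap_coface _ (by omega)
    | exact isSimplexMap_id (by omega)
    | (intro k hk; rfl)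

lemma incl_verD (p q : ℕ) (z : Z p q) :
    𝒵.incl p (q + 1) (𝒵.verD p q z) = 𝒵.verE p q (𝒵.incl p q z) := by
  refine map_altSum _ _ _ _ fun i hi => 𝒵.map_comm z ?_ ?_ ?_ ?_ ?_ ?_ ?_ ?_ ?_ ?_
  all_goals first
    | exact isSimplexMap_coface _ (by omega)
    | exact isSimplexMap_id (by omega)
    | (intro k hk; simp only [coface, id]; split_ifs <;> omega)
    | (intro k hk; rfl)

lemma retr_verE (p q : ℕ) (z : Z (p + q + 1) q) :
    𝒵.retr p (q + 1) (𝒵.verE p q z) = 𝒵.verD p q (𝒵.retr p q z) := by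
  refine map_altSum _ _ _ _ fun i hi => 𝒵.map_comm z ?_ ?_ ?_ ?_ ?_ ?_ ?_ ?_ ?_ ?_
  all_goals first
    | exact isSimplexMap_coface _ (by omega)
    | exact isSimplexMap_id (by omega)
    | exact isSimplexMap_min
    | (intro k hk; simp only [coface, id]; split_ifs <;> omega)
    | (intro k hk; rfl)

lemma retr_incl (p q : ℕ) (z : Z p q) : 𝒵.retr p q (𝒵.incl p q z) = z :=
  𝒵.map_map_eq_self z (isSimplexMap_id (by omega)) isSimplexMap_min (isSimplexMap_id le_rfl)
    (isSimplexMap_id le_rfl) (fun _ hk => min_eq_right hk) fun _ _ => rfl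

/-- This is $hd+dh=1-\mathrm{incl}\circ\mathrm{retr}$ for fixed $p$. The extreme prism terms are the
identity and the collapse of $[q]$ to the last vertex of $[p]$. The term $dh$ is spelled out as a
double sum to include $q=0$, where the sum over `i` is empty and the truncated `q - 1` plays no
role. -/
lemma homotopy_verE (p q : ℕ) (z : Z (p + q + 1) q) :
    𝒵.homotopy p q (𝒵.verE p q z) +
      ∑ j ∈ Finset.range (q + 1), ∑ i ∈ Finset.range q, (-1 : ℤ) ^ (i + j) •
        𝒵.map (coface (p + 1 + j)) (coface j)
          (𝒵.map (prism p i) (codegeneracy i) z : Z (p + (q - 1) + 1) (q - 1)) =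
      z - 𝒵.incl p q (𝒵.retr p q z) := by
  rw [homotopy, verE, altSum_altSum]
  have h := sum_homotopy q (fun i j => (𝒵.map (prism p i) (codegeneracy i)
      (𝒵.map (coface (p + 1 + j)) (coface j) z : Z (p + (q + 1) + 1) (q + 1)) : Z (p + q + 1) q))
    (fun j i => 𝒵.map (coface (p + 1 + j)) (coface j)
      (𝒵.map (prism p i) (codegeneracy i) z : Z (p + (q - 1) + 1) (q - 1))) ?_ ?_ ?_
  · refine h.trans ?_
    congr 1
    · refine 𝒵.map_map_eq_self z ?_ ?_ ?_ ?_ ?_ ?_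
      all_goals first
        | exact isSimplexMap_coface _ (by omega)
        | exact isSimplexMap_prism _ _ (by omega) (by omega)
        | exact isSimplexMap_codegeneracy _ (by omega) (by omega)
        | (intro k hk; simp only [coface, prism, codegeneracy]; split_ifs <;> omega)
    · refine 𝒵.map_comm z ?_ ?_ ?_ ?_ ?_ ?_ ?_ ?_ ?_ ?_
      all_goals first
        | exact isSimplexMap_coface _ (by omega)
        | exact isSimplexMap_id (by omega)
        | exact isSimplexMap_min
        | exact isSimplexMap_prism _ _ (by omega) (by omega)
        | exact isSimplexMap_codegeneracy _ (by omega) (by omega)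
        | (intro k hk; simp only [coface, prism, codegeneracy, id]; split_ifs <;> omega)
  · intro i j hj hi
    refine 𝒵.map_comm z ?_ ?_ ?_ ?_ ?_ ?_ ?_ ?_ ?_ ?_
    all_goals first
      | exact isSimplexMap_coface _ (by omega)
      | exact isSimplexMap_prism _ _ (by omega) (by omega)
      | exact isSimplexMap_codegeneracy _ (by omega) (by omega)
      | (intro k hk; simp only [coface, prism, codegeneracy]; split_ifs <;> omega)
  · intro i j hj hi
    refine 𝒵.map_comm z ?_ ?_ ?_ ?_ ?_ ?_ ?_ ?_ ?_ ?_
    all_goals first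
      | exact isSimplexMap_coface _ (by omega)
      | exact isSimplexMap_prism _ _ (by omega) (by omega)
      | exact isSimplexMap_codegeneracy _ (by omega) (by omega)
      | (intro k hk; simp only [coface, prism, codegeneracy]; split_ifs <;> omega)
  · intro i hi
    refine 𝒵.map_comm z ?_ ?_ ?_ ?_ ?_ ?_ ?_ ?_ ?_ ?_
    all_goals first
      | exact isSimplexMap_coface _ (by omega)
      | exact isSimplexMap_prism _ _ (by omega) (by omega)
      | exact isSimplexMap_codegeneracy _ (by omega) (by omega)
      | (intro k hk; simp only [coface, prism, codegeneracy]; split_ifs <;> omega)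

/-- Every row of the map from the total complex to `totE` has a homotopy inverse. -/
lemma isQuasiIso_incl (p : ℕ) :
    (ofComplex (𝒵.verD p) (𝒵.verD_verD p)).IsQuasiIso (ofComplex (𝒵.verE p) (𝒵.verE_verE p))
      (totalMap fun q => 𝒵.incl p q) := by
  intro x' x h1 h2
  have hr : ∀ y : ∀ q, Z (p + q + 1) q, (totalMap fun q => 𝒵.retr p q) (shift (𝒵.verE p) y) =
      shift (𝒵.verD p) ((totalMap fun q => 𝒵.retr p q) y) := fun y =>
    funext fun q => shift_map (fun q => 𝒵.retr p q) (fun q z => 𝒵.retr_verE p q z) y q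
  have hi : ∀ y : ∀ q, Z p q, (totalMap fun q => 𝒵.incl p q) (shift (𝒵.verD p) y) =
      shift (𝒵.verE p) ((totalMap fun q => 𝒵.incl p q) y) := fun y =>
    funext fun q => shift_map (fun q => 𝒵.incl p q) (fun q z => 𝒵.incl_verD p q z) y q
  have hri : ∀ y : ∀ q, Z p q, (totalMap fun q => 𝒵.retr p q) ((totalMap fun q =>
      𝒵.incl p q) y) = y :=
    fun y => funext fun q => 𝒵.retr_incl p q (y q)
  have h1 : shift (𝒵.verE p) x' + (totalMap fun q => 𝒵.incl p q) x = 0 := h1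
  -- Apply the retraction to the cycle condition; it splits the inclusion.
  have hx : x = -shift (𝒵.verD p) ((totalMap fun q => 𝒵.retr p q) x') := by
    have := congrArg (totalMap fun q => 𝒵.retr p q) h1
    rw [map_add, hr, hri, map_zero] at this
    exact eq_neg_of_add_eq_zero_right this
  -- What remains is a cocycle killed by the retraction, so the homotopy formula reduces to
  -- $y=d(hy)$.
  obtain ⟨y, hy⟩ : ∃ y, y = x' - (totalMap fun q => 𝒵.incl p q) ((totalMap fun q =>
      𝒵.retr p q) x') :=
    ⟨_, rfl⟩
  have hdy : shift (𝒵.verE p) y = 0 := by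
    rw [hy, map_sub, ← hi, eq_neg_of_add_eq_zero_left h1, hx, map_neg, neg_neg, sub_self]
  have hry : ∀ q, 𝒵.retr p q (y q) = 0 := fun q => by
    have : (totalMap fun q => 𝒵.retr p q) y = 0 := by rw [hy, map_sub, hri, sub_self]
    exact congrFun this q
  refine ⟨fun q => 𝒵.homotopy p q (y (q + 1)), (totalMap fun q => 𝒵.retr p q) x', ?_, hx⟩
  suffices h : y = shift (𝒵.verE p) fun q => 𝒵.homotopy p q (y (q + 1)) by
    show x' = shift (𝒵.verE p) _ + _
    rw [← h, hy, sub_add_cancel]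
  funext q
  have h := 𝒵.homotopy_verE p q (y q)
  have hq : 𝒵.verE p q (y q) = 0 := congrFun hdy (q + 1)
  rw [hry, map_zero, sub_zero, hq, map_zero, zero_add] at h
  refine h.symm.trans ?_
  cases q with
  | zero => simp
  | succ q => exact (altSum_altSum _ _ _ _ _).symm

end Bicosimplicial

/-! ### Comparison of the diagonal with the join complex -/

namespace Bicosimplicial

variable {Z : ℕ → ℕ → Type*} [∀ m n, AddCommGroup (Z m n)] (𝒵 : Bicosimplicial Z)

/-- The graded differential group of the diagonal of a bicosimplicial group. -/
def diag : GradedDifferential (∀ n, Z n n) := ofComplex 𝒵.diagD 𝒵.diagD_diagD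

/-- The augmentation from the diagonal to the first row of the groups `Z (p + q + 1) q`. -/
def aug (q : ℕ) : Z q q →+ Z (0 + q + 1) q := 𝒵.map (coface 0) id

lemma aug_diagD (q : ℕ) (z : Z q q) :
    𝒵.aug (q + 1) (𝒵.diagD q z) = 𝒵.verE 0 q (𝒵.aug q z) := by
  refine map_altSum _ _ _ _ fun i hi => 𝒵.map_comm z ?_ ?_ ?_ ?_ ?_ ?_ ?_ ?_ ?_ ?_
  all_goals first
    | exact isSimplexMap_coface _ (by omega)
    | exact isSimplexMap_id (by omega)
    | (intro k hk; simp only [coface]; split_ifs <;> omega)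
    | (intro k hk; rfl)

/-- The cofaces 0 and 1 of $[0]$ agree after composition with the inclusion $[q]\to[0]*[q]$, because
both composites are the inclusion of $[q]$ into $[1]*[q]$. -/
lemma horE_aug (q : ℕ) (z : Z q q) : 𝒵.horE 0 q (𝒵.aug q z) = 0 := by
  have : (𝒵.map (coface 1) id (𝒵.map (coface 0) id z : Z (0 + q + 1) q) : Z (0 + 1 + q + 1) q) =
      𝒵.map (coface 0) id (𝒵.map (coface 0) id z : Z (0 + q + 1) q) := by
    refine 𝒵.map_comm z ?_ ?_ ?_ ?_ ?_ ?_ ?_ ?_ ?_ ?_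
    all_goals first
      | exact isSimplexMap_coface _ (by omega)
      | exact isSimplexMap_id (by omega)
      | (intro k hk; simp only [coface]; split_ifs <;> omega)
      | (intro k hk; rfl)
  simp [horE, aug, altSum_apply, Finset.sum_range_succ, this]

lemma eq_zero_of_aug_eq_zero (q : ℕ) (z : Z q q) (h : 𝒵.aug q z = 0) : z = 0 := by
  have := 𝒵.map_map_eq_self (m' := 0 + q + 1) (n' := q) (α := coface 0) (α' := codegeneracy 0)
    (β := id) (β' := id) z (isSimplexMap_coface _ (by omega))
    (isSimplexMap_codegeneracy _ (by omega) (by omega)) (isSimplexMap_id le_rfl)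
    (isSimplexMap_id le_rfl) (fun k hk => by simp [coface, codegeneracy]) fun _ _ => rfl
  rw [← this]
  exact (congrArg _ h).trans (map_zero _)

/-- The extra codegeneracy: it merges the last vertex of $[p+1]$ with the first vertex of $[q]$ in
the join. It is inverse to the last coface and commutes with the earlier ones up to a shift, hence
it contracts the complex $p\mapsto Z([p]*[q],[q])$ augmented by $Z^{q,q}$. -/
lemma codegeneracy_horE (p q : ℕ) (z : Z (p + q + 1) q) :
    (𝒵.map (codegeneracy (p + 1)) id (𝒵.horE p q z) : Z (p + q + 1) q) =
      altSum (p + 1) (fun i => 𝒵.map (coface i) id)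
        (𝒵.map (codegeneracy p) id z : Z (p + q) q) + (-1 : ℤ) ^ (p + 1) • z := by
  rw [horE, altSum_apply, map_sum, Finset.sum_range_succ, map_zsmul]
  congr 1
  · rw [altSum_apply]
    refine Finset.sum_congr rfl fun i hi => ?_
    have hi := Finset.mem_range.1 hi
    rw [map_zsmul]
    congr 1
    refine 𝒵.map_comm z ?_ ?_ ?_ ?_ ?_ ?_ ?_ ?_ ?_ ?_
    all_goals first
      | exact isSimplexMap_coface _ (by omega)
      | exact isSimplexMap_id (by omega)
      | exact isSimplexMap_codegeneracy _ (by omega) (by omega)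
      | (intro k hk; simp only [coface, codegeneracy]; split_ifs <;> omega)
      | (intro k hk; rfl)
  · congr 1
    refine 𝒵.map_map_eq_self z ?_ ?_ ?_ ?_ ?_ ?_
    all_goals first
      | exact isSimplexMap_coface _ (by omega)
      | exact isSimplexMap_id (by omega)
      | exact isSimplexMap_codegeneracy _ (by omega) (by omega)
      | (intro k hk; simp only [coface, codegeneracy]; split_ifs <;> omega)
      | (intro k hk; rfl)

lemma exists_aug_eq (q : ℕ) (z : Z (0 + q + 1) q) (h : 𝒵.horE 0 q z = 0) :
    ∃ y, 𝒵.aug q y = z := by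
  have h1 := 𝒵.codegeneracy_horE 0 q z
  rw [h, map_zero, altSum_apply] at h1
  simp only [zero_add, Finset.range_one, Finset.sum_singleton, pow_zero, one_smul, pow_one,
    neg_smul] at h1
  have h2 := eq_of_sub_eq_zero ((sub_eq_add_neg _ _).trans h1.symm)
  refine ⟨𝒵.map (codegeneracy 0) id z, Eq.trans ?_ h2⟩
  refine 𝒵.map_comm z ?_ ?_ ?_ ?_ ?_ ?_ ?_ ?_ ?_ ?_
  all_goals first
    | exact isSimplexMap_coface _ (by omega)
    | exact isSimplexMap_id (by omega)
    | exact isSimplexMap_codegeneracy _ (by omega) (by omega)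
    | (intro k hk; rfl)

lemma exists_horE_eq (p q : ℕ) (z : Z (p + 1 + q + 1) q) (h : 𝒵.horE (p + 1) q z = 0) :
    ∃ y, 𝒵.horE p q y = z := by
  have h1 := 𝒵.codegeneracy_horE (p + 1) q z
  rw [h, map_zero] at h1
  refine ⟨(-1 : ℤ) ^ (p + 1) • 𝒵.map (codegeneracy (p + 1)) id z, ?_⟩
  -- The indices `p + q + 1` and `p + 1 + q` are not definitionally equal, so the degenerate element
  -- exists in two groups. Their images coincide because both are composites starting at `z`.
  have h2 : 𝒵.horE p q (𝒵.map (codegeneracy (p + 1)) id z) =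
      altSum (p + 1 + 1) (fun i => 𝒵.map (coface i) id)
        (𝒵.map (codegeneracy (p + 1)) id z : Z (p + 1 + q) q) := by
    refine Finset.sum_congr rfl ?_ |> fun h =>
        (altSum_apply _ _ _).trans (h.trans (altSum_apply _ _ _).symm)
    intro i _
    congr 1
    refine 𝒵.map_comm z ?_ ?_ ?_ ?_ ?_ ?_ ?_ ?_ ?_ ?_
    all_goals first
      | exact isSimplexMap_coface _ (by omega)
      | exact isSimplexMap_id (by omega)
      | exact isSimplexMap_codegeneracy _ (by omega) (by omega)
      | (intro k hk; rfl)
  have hs : (-1 : ℤ) ^ (p + 1) * (-1) ^ (p + 1) = 1 := by rw [← mul_pow]; simp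
  have h3 : altSum (p + 1 + 1) (fun i => 𝒵.map (coface i) id)
        (𝒵.map (codegeneracy (p + 1)) id z : Z (p + 1 + q) q) = (-1 : ℤ) ^ (p + 1) • z := by
    rw [eq_neg_of_add_eq_zero_left h1.symm, pow_succ _ (p + 1), mul_neg_one, neg_smul, neg_neg]
  rw [map_zsmul, h2, h3, smul_smul, hs, one_smul]

/-- The map from the diagonal to `totE`. -/
def diagToE : (∀ n, Z n n) →+ ∀ p q, Z (p + q + 1) q :=
  AddMonoidHom.mk' (fun x p => match p with
    | 0 => fun q => 𝒵.aug q (x q)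
    | _ + 1 => 0) fun x y => by
      funext p q
      cases p <;> simp

lemma diagToE_zero (x : ∀ n, Z n n) (q : ℕ) : 𝒵.diagToE x 0 q = 𝒵.aug q (x q) := rfl

lemma diagToE_succ (x : ∀ n, Z n n) (p q : ℕ) : 𝒵.diagToE x (p + 1) q = 0 := rfl

lemma totE_d_apply (x : ∀ p q, Z (p + q + 1) q) (p q : ℕ) :
    𝒵.totE.d x p q = (-1 : ℤ) ^ p • shift (𝒵.verE p) (x p) q +
      shift (R := fun p => Z (p + q + 1) q) (fun p => 𝒵.horE p q) (fun p => x p q) p := by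
  cases p <;> rfl

lemma diagToE_d (x : ∀ n, Z n n) : 𝒵.diagToE (𝒵.diag.d x) = 𝒵.totE.d (𝒵.diagToE x) := by
  funext p q
  rw [totE_d_apply]
  match p with
  | 0 =>
    rw [diagToE_zero, pow_zero, one_smul, shift_zero, add_zero]
    exact shift_map (fun q => 𝒵.aug q) (fun q z => 𝒵.aug_diagD q z) x q
  | 1 =>
    have : 𝒵.diagToE x 1 = 0 := rfl
    rw [diagToE_succ, shift_succ, this, map_zero, diagToE_zero, horE_aug]
    simp
  | p + 2 =>
    have : 𝒵.diagToE x (p + 2) = 0 := rfl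
    rw [diagToE_succ, shift_succ, this, map_zero, diagToE_succ]
    simp

/-- For fixed $q$ the augmented complex $0\to Z^{q,q}\to E^{0,q}\to E^{1,q}\to\cdots$ is exact by
the extra codegeneracy. The cone is the total complex of these rows. -/
lemma isQuasiIso_diagToE : 𝒵.diag.IsQuasiIso 𝒵.totE 𝒵.diagToE := by
  intro x' x h1 h2
  let a : ∀ q, Z q q →+ ∀ p, Z (p + q + 1) q := fun q =>
    AddMonoidHom.mk' (fun z p => match p with
      | 0 => 𝒵.aug q z
      | _ + 1 => 0) fun x y => by
        funext p
        cases p <;> simp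
  have a0 : ∀ q z, a q z 0 = 𝒵.aug q z := fun _ _ => rfl
  have a1 : ∀ q z p, a q z (p + 1) = 0 := fun _ _ _ => rfl
  -- The cone is regrouped with $q$ as the outer index: `dC` is the differential of the augmented
  -- row, and `eC` collects the vertical and the diagonal differential. The sign $(-1)^p$ now
  -- belongs to `eC`.
  let dC : ∀ q, (∀ p, Z (p + q + 1) q) × Z q q →+ (∀ p, Z (p + q + 1) q) × Z q q :=
      fun q => AddMonoidHom.mk'
    (fun c => (shift (R := fun p => Z (p + q + 1) q) (fun p => 𝒵.horE p q) c.1 + a q c.2, 0))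
    fun c c' => by
      refine Prod.ext ?_ (add_zero _).symm
      simp only [Prod.fst_add, Prod.snd_add, map_add]
      abel
  let eC : ∀ q, (∀ p, Z (p + q + 1) q) × Z q q →+
      (∀ p, Z (p + (q + 1) + 1) (q + 1)) × Z (q + 1) (q + 1) := fun q => AddMonoidHom.mk'
    (fun c => (fun p => (-1 : ℤ) ^ p • 𝒵.verE p q (c.1 p), -𝒵.diagD q c.2))
    fun c c' => by
      refine Prod.ext (funext fun p => ?_) ?_
      · simp only [Prod.fst_add, Pi.add_apply, map_add, smul_add]
      · simp only [Prod.snd_add, map_add, neg_add]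
  have hs : ∀ (z : ∀ q, (∀ p, Z (p + q + 1) q) × Z q q) (q : ℕ),
      shift eC z q = (fun p => (-1 : ℤ) ^ p • shift (𝒵.verE p) (fun q => (z q).1 p) q,
        -shift 𝒵.diagD (fun q => (z q).2) q) := by
    intro z q
    cases q with
    | zero =>
      refine Prod.ext (funext fun p => ?_) ?_
      · simp
      · simp
    | succ q => rfl
  have hanti : ∀ q c, dC (q + 1) (eC q c) = -eC q (dC q c) := by
    rintro q ⟨u, k⟩
    refine Prod.ext (funext fun p => ?_) (by simp [dC, eC])
    simp only [dC, eC, AddMonoidHom.mk'_apply, Pi.add_apply, Prod.fst_neg, Pi.neg_apply, map_neg]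
    match p with
    | 0 => simp [a0, aug_diagD]
    | p + 1 =>
      have hp : (-1 : ℤ) ^ (p + 1) = -(-1) ^ p := by ring
      simp only [shift_succ, map_zsmul, a1, add_zero, neg_zero, hp, neg_smul,
        neg_neg, verE_horE]
  have hsq : ∀ q c, eC (q + 1) (eC q c) = 0 := by
    rintro q ⟨u, k⟩
    refine Prod.ext (funext fun p => ?_) ?_
    · simp [eC, verE_verE]
    · simp [eC, diagD_diagD]
  have hrow : ∀ q c, dC q c = 0 → ∃ b, dC q b = c := by
    rintro q ⟨u, k⟩ h
    have h0 : ∀ p, shift (R := fun p => Z (p + q + 1) q) (fun p => 𝒵.horE p q) u p + a q k p = 0 :=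
      fun p => congrFun (congrArg Prod.fst h) p
    -- Exactness at the three kinds of places: the augmentation is injective, its image is the
    -- kernel in $E^{0,q}$, and the row is exact at $E^{p+1,q}$.
    have hk : k = 0 := by
      refine 𝒵.eq_zero_of_aug_eq_zero q k ?_
      simpa [a0] using h0 0
    obtain ⟨l, hl⟩ := 𝒵.exists_aug_eq q (u 0) (by simpa [a1] using h0 1)
    choose b hb using fun p => 𝒵.exists_horE_eq p q (u (p + 1)) (by simpa [a1] using h0 (p + 2))
    refine ⟨(b, l), Prod.ext (funext fun p => ?_) hk.symm⟩
    cases p with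
    | zero => simpa [dC, a0] using hl
    | succ p => simpa [dC, a1] using hb p
  have hx : ∀ q, dC q (fun p => x' p q, x q) + shift eC (fun q => (fun p => x' p q, x q)) q = 0 :=
      by
    intro q
    rw [hs]
    refine Prod.ext (funext fun p => ?_) ?_
    · have h : 𝒵.totE.d x' p q + a q (x q) p = 0 := by
        have := congrFun (congrFun h1 p) q
        cases p <;> exact this
      rw [totE_d_apply] at h
      refine Eq.trans ?_ h
      simp only [dC, AddMonoidHom.mk'_apply, Prod.fst_add, Pi.add_apply]
      abel
    · have h : shift 𝒵.diagD x q = 0 := congrFun h2 q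
      simp [dC, h]
  obtain ⟨y, hy⟩ := exists_of_rows_exact dC eC hanti hsq hrow (fun q => (fun p => x' p q, x q)) hx
  refine ⟨fun p q => (y q).1 p, fun q => (y q).2, ?_, ?_⟩
  · funext p q
    have h := congrFun (congrArg Prod.fst (hy q)) p
    rw [hs] at h
    refine h.trans ?_
    have h3 : 𝒵.diagToE (fun q => (y q).2) p q = a q (y q).2 p := by cases p <;> rfl
    rw [Pi.add_apply, Pi.add_apply, totE_d_apply, h3]
    simp only [dC, AddMonoidHom.mk'_apply, Prod.fst_add, Pi.add_apply]
    abel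
  · funext q
    have h := congrArg Prod.snd (hy q)
    rw [hs] at h
    refine h.trans ?_
    simp only [dC, AddMonoidHom.mk'_apply, Prod.snd_add, zero_add]
    rfl

/-- The **Eilenberg–Zilber theorem**: the diagonal complex of a bicosimplicial group has the same
cohomology as the total complex. -/
theorem nonempty_diag_equiv_tot (n : ℕ) : Nonempty (𝒵.diag.H n ≃+ 𝒵.tot.H n) := by
  obtain ⟨e₁⟩ := 𝒵.isQuasiIso_diagToE.nonempty_equiv 𝒵.diagToE_d (fun n x => by
    funext p q
    cases p with
    | zero =>
      show 𝒵.aug q (component _ n x q) = component _ n (𝒵.diagToE x 0) q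
      simp only [component_apply, diagToE_zero]
      split_ifs <;> simp
    | succ p =>
      refine (𝒵.diagToE_succ _ p q).trans ?_
      rw [totE, total_proj_apply]
      have : 𝒵.diagToE x (p + 1) = 0 := rfl
      rw [this, map_zero, ite_self]
      rfl) n
  have h : 𝒵.tot.IsQuasiIso 𝒵.totE (totalMap fun p => totalMap fun q => 𝒵.incl p q) := by
    exact isQuasiIso_totalMap (fun p => totalMap fun q => 𝒵.incl p q)
      (fun p x => funext fun q => 𝒵.incl_horD p q (x q)) 𝒵.isQuasiIso_incl
  obtain ⟨e₂⟩ := h.nonempty_equiv (fun x => by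
    funext p q
    have h1 := shift_map (fun q => 𝒵.incl p q) (fun q z => 𝒵.incl_verD p q z) (x p) q
    have h2 := shift_map (R := fun p => ∀ q, Z p q) (R' := fun p => ∀ q, Z (p + q + 1) q)
      (e := fun p => totalMap fun q => 𝒵.horD p q) (e' := fun p => totalMap fun q => 𝒵.horE p q)
      (fun p => totalMap fun q => 𝒵.incl p q)
      (fun p x => funext fun q => 𝒵.incl_horD p q (x q)) x p
    have h2 := congrFun h2 q
    simp only [tot, totE, totalMap_apply, total_d_apply, Pi.add_apply, Pi.smul_apply, map_add,
      map_zsmul] at h2 ⊢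
    exact congrArg₂ (fun a b => (-1 : ℤ) ^ p • a + b) h1 h2) (fun n x => by
    funext p q
    simp only [tot, totE, totalMap_apply, total_proj_apply]
    split_ifs
    · simp only [ofComplex, component_apply]
      split_ifs <;> simp [totalMap_apply]
    · simp) n
  exact ⟨e₁.trans e₂.symm⟩

end Bicosimplicial

/-! ### Cochains on a simplicial set with values in a graded differential group -/

section Coefficients

variable {S : ℕ → Type*} {T T' : Type*} [AddCommGroup T] [AddCommGroup T']

/-- Composition with `c`, as a homomorphism. -/
def precomp {S₁ S₂ : Type*} (T : Type*) [AddCommGroup T] (c : S₂ → S₁) : (S₁ → T) →+ (S₂ → T) :=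
  AddMonoidHom.mk' (fun x s => x (c s)) fun _ _ => rfl

/-- Composition with the homomorphism `f`. -/
def mapCoeff (S : Type*) (f : T →+ T') : (S → T) →+ (S → T') :=
  AddMonoidHom.mk' (fun x s => f (x s)) fun x y => by
    funext s
    simp

/-- The pointwise graded differential group of functions. -/
def GradedDifferential.pi (𝒯 : GradedDifferential T) (S : Type*) : GradedDifferential (S → T) where
  d := mapCoeff S 𝒯.d
  proj n := mapCoeff S (𝒯.proj n)
  d_d x := funext fun s => 𝒯.d_d (x s)
  proj_proj n x := funext fun s => 𝒯.proj_proj n (x s)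
  proj_zero_d x := funext fun s => 𝒯.proj_zero_d (x s)
  proj_succ_d n x := funext fun s => 𝒯.proj_succ_d n (x s)

/-- Primitives in the cone can be chosen separately at every point of `S`: products of abelian
groups are exact. -/
lemma GradedDifferential.IsQuasiIso.pi {𝒯 : GradedDifferential T} {𝒯' : GradedDifferential T'}
    {f : T →+ T'} (hf : 𝒯.IsQuasiIso 𝒯' f) (S : Type*) :
    (𝒯.pi S).IsQuasiIso (𝒯'.pi S) (mapCoeff S f) := by
  intro x' x h1 h2
  choose y' y hy' hy using fun s => hf (x' s) (x s) (congrFun h1 s) (congrFun h2 s)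
  exact ⟨y', y, funext hy', funext hy⟩

/-- The differential of the cochains on a simplicial set with faces `c`. -/
def faceD (c : ∀ p, ℕ → S (p + 1) → S p) (T : Type*) [AddCommGroup T] (p : ℕ) :
    (S p → T) →+ (S (p + 1) → T) :=
  altSum (p + 2) fun i => precomp T (c p i)

lemma mapCoeff_faceD (c : ∀ p, ℕ → S (p + 1) → S p) (f : T →+ T') (p : ℕ) (x : S p → T) :
    mapCoeff (S (p + 1)) f (faceD c T p x) = faceD c T' p (mapCoeff (S p) f x) :=
  map_altSum _ _ _ _ fun _ _ => rfl

/-- The simplicial identities for the faces. -/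
def IsSimplicial (c : ∀ p, ℕ → S (p + 1) → S p) : Prop :=
  ∀ p i j, i ≤ j → j ≤ p + 1 → ∀ s, c p i (c (p + 1) (j + 1) s) = c p j (c (p + 1) i s)

lemma faceD_faceD {c : ∀ p, ℕ → S (p + 1) → S p} (hc : IsSimplicial c) (p : ℕ) (x : S p → T) :
    faceD c T (p + 1) (faceD c T p x) = 0 := by
  rw [faceD, faceD, altSum_altSum]
  exact sum_cosimplicial_eq_zero (p + 1) _ fun i j hi hj => funext fun s =>
    congrArg x (hc p i j hi hj s)

/-- The total complex of the cochains with values in a graded differential group. -/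
def GradedDifferential.cochains (𝒯 : GradedDifferential T) {c : ∀ p, ℕ → S (p + 1) → S p}
    (hc : IsSimplicial c) : GradedDifferential (∀ p, S p → T) :=
  total (fun p => 𝒯.pi (S p)) (fun p => faceD c T p) (fun p x => mapCoeff_faceD c 𝒯.d p x)
    (fun n p x => mapCoeff_faceD c (𝒯.proj n) p x) (fun p x => faceD_faceD hc p x)

lemma GradedDifferential.cochains_d_apply (𝒯 : GradedDifferential T)
    {c : ∀ p, ℕ → S (p + 1) → S p} (hc : IsSimplicial c) (x : ∀ p, S p → T) (p : ℕ) :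
    (𝒯.cochains hc).d x p =
      (-1 : ℤ) ^ p • mapCoeff (S p) 𝒯.d (x p) + shift (fun p => faceD c T p) x p := rfl

lemma GradedDifferential.cochains_proj_apply (𝒯 : GradedDifferential T)
    {c : ∀ p, ℕ → S (p + 1) → S p} (hc : IsSimplicial c) (n : ℕ) (x : ∀ p, S p → T) (p : ℕ) :
    (𝒯.cochains hc).proj n x p = if p ≤ n then mapCoeff (S p) (𝒯.proj (n - p)) (x p) else 0 := rfl

/-- The cohomology of the total complex of cochains only depends on the quasi-isomorphism class of
the coefficients. -/
theorem GradedDifferential.IsQuasiIso.nonempty_cochains_equiv {𝒯 : GradedDifferential T}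
    {𝒯' : GradedDifferential T'} {f : T →+ T'} (hf : 𝒯.IsQuasiIso 𝒯' f)
    (hd : ∀ x, f (𝒯.d x) = 𝒯'.d (f x)) (hp : ∀ n x, f (𝒯.proj n x) = 𝒯'.proj n (f x))
    {c : ∀ p, ℕ → S (p + 1) → S p} (hc : IsSimplicial c) (n : ℕ) :
    Nonempty ((𝒯.cochains hc).H n ≃+ (𝒯'.cochains hc).H n) := by
  have h : (𝒯.cochains hc).IsQuasiIso (𝒯'.cochains hc) (totalMap fun p => mapCoeff (S p) f) :=
    isQuasiIso_totalMap (fun p => mapCoeff (S p) f) (fun p x => mapCoeff_faceD c f p x)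
      fun p => hf.pi (S p)
  refine h.nonempty_equiv (fun x => ?_) (fun n x => ?_) n
  · funext p
    rw [totalMap_apply, cochains_d_apply, cochains_d_apply, map_add, map_zsmul,
      shift_map (fun p => mapCoeff (S p) f) (fun p x => mapCoeff_faceD c f p x) x p]
    congr 2
    exact funext fun s => hd (x p s)
  · funext p
    rw [totalMap_apply, cochains_proj_apply, cochains_proj_apply]
    split_ifs
    · exact funext fun s => hp _ (x p s)
    · exact map_zero _

end Coefficients

/-! ### Complexes of abelian groups are formal -/

section Formality

variable {X : ℕ → Type*} [∀ q, AddCommGroup (X q)] {d : ∀ q, X q →+ X (q + 1)}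
  {B : ℕ → Type*} [∀ q, AddCommGroup (B q)]

/-- The complex with differential zero. -/
abbrev zeroComplex (B : ℕ → Type*) [∀ q, AddCommGroup (B q)] : GradedDifferential (∀ q, B q) :=
  ofComplex (fun _ => 0) fun _ _ => rfl

/-- The quotient of the divisible hull of `B` by `B`. -/
abbrev HullQuotient (B : Type*) [AddCommGroup B] : Type _ :=
  DivisibleHull B ⧸ (toDivisibleHull B).range

/-- The complex that consists of injective resolutions of the groups `B q`. -/
def resolution (B : ℕ → Type*) [∀ q, AddCommGroup (B q)] :
    GradedDifferential ((∀ q, DivisibleHull (B q)) × ∀ q, HullQuotient (B q)) where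
  d := AddMonoidHom.mk' (fun x => (0, fun q => QuotientAddGroup.mk (x.1 q))) fun x y =>
    Prod.ext (add_zero _).symm rfl
  proj n := AddMonoidHom.mk'
    -- The quotient with index `q` is the second term of the resolution of `B q`, so it sits in
    -- degree `q + 1`.
    (fun x => (component _ n x.1, fun q => if q + 1 = n then x.2 q else 0)) fun x y => by
      refine Prod.ext (map_add _ _ _) (funext fun q => ?_)
      simp only [Prod.snd_add, Pi.add_apply]
      split_ifs <;> simp
  d_d x := rfl
  proj_proj n x := by
    refine Prod.ext (funext fun q => ?_) (funext fun q => ?_)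
    · simp only [AddMonoidHom.mk'_apply, component_apply]
      split_ifs <;> rfl
    · simp only [AddMonoidHom.mk'_apply]
      split_ifs <;> rfl
  proj_zero_d x := Prod.ext (map_zero _) rfl
  proj_succ_d n x := by
    refine Prod.ext (map_zero _) (funext fun q => ?_)
    simp only [AddMonoidHom.mk'_apply, component_apply, Nat.add_right_cancel_iff]
    split_ifs <;> rfl

/-- A complex with cohomology groups `B q` is related by quasi-isomorphisms to the complex with
entries `B q` and differential zero. Hence they give the same total complexes of cochains. -/
theorem nonempty_cochains_equiv_of_cohomology (hd : ∀ q x, d (q + 1) (d q x) = 0)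
    (π : ∀ q, (d q).ker →+ B q) (hπ : ∀ q, Function.Surjective (π q))
    (hπ' : ∀ q (z : (d q).ker), π q z = 0 ↔ ∃ y, shift d y q = z)
    {S : ℕ → Type*} {c : ∀ p, ℕ → S (p + 1) → S p} (hc : IsSimplicial c) (n : ℕ) :
    Nonempty (((ofComplex d hd).cochains hc).H n ≃+ ((zeroComplex B).cochains hc).H n) := by
  -- `α` extends the cohomology class of a cocycle, viewed in the divisible hull, to all cochains.
  choose α hα using fun q => exists_extension_of_divisible (Q :=
      DivisibleHull (B q)) (d q).ker.subtype
    ((toDivisibleHull (B q)).comp (π q)) fun x hx => by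
      obtain rfl : x = 0 := Subtype.ext hx
      exact map_zero _
  -- On cocycles `α` takes values in `B q`, so modulo `B q` it depends only on the coboundary.
  -- Divisibility of the quotient extends it from the coboundaries to `X (q + 1)`. Thus `α` and `β`
  -- form a morphism to the resolution.
  choose β hβ using fun q => exists_extension_of_divisible (Q := HullQuotient (B q)) (d q)
    ((QuotientAddGroup.mk' _).comp (α q)) fun x hx =>
      (QuotientAddGroup.eq_zero_iff _).2 ⟨π q ⟨x, hx⟩, (hα q ⟨x, hx⟩).symm⟩
  have hα' : ∀ q (x : X q) (hx : d q x = 0), α q x = toDivisibleHull (B q) (π q ⟨x, hx⟩) :=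
    fun q x hx => hα q ⟨x, hx⟩
  have hβ' : ∀ q x, β q (d q x) = QuotientAddGroup.mk (α q x) := hβ
  have hdd : ∀ x q, d q (shift d x q) = 0 := fun x q => congrFun (shift_shift d hd x) (q + 1)
  have hαd : ∀ x q, α q (shift d x q) = 0 := fun x q => by
    rw [hα' q _ (hdd x q), (hπ' q ⟨_, hdd x q⟩).2 ⟨x, rfl⟩, map_zero]
  let f : (∀ q, X q) →+ (∀ q, DivisibleHull (B q)) × ∀ q, HullQuotient (B q) :=
    AddMonoidHom.mk' (fun x => (fun q => α q (x q), fun q => β q (x (q + 1)))) fun x y =>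
      Prod.ext (funext fun q => map_add _ _ _) (funext fun q => map_add _ _ _)
  let g : (∀ q, B q) →+ (∀ q, DivisibleHull (B q)) × ∀ q, HullQuotient (B q) :=
    AddMonoidHom.mk' (fun x => (fun q => toDivisibleHull (B q) (x q), 0)) fun x y =>
      Prod.ext (funext fun q => map_add _ _ _) (add_zero _).symm
  have hf : (ofComplex d hd).IsQuasiIso (resolution B) f := by
    rintro ⟨i, j⟩ x h1 h2
    have hx : ∀ q, d q (x q) = 0 := fun q => congrFun h2 (q + 1)
    have h3 : ∀ q, α q (x q) = 0 := fun q => by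
      simpa [resolution, f] using congrFun (congrArg Prod.fst h1) q
    have h4 : ∀ q, (QuotientAddGroup.mk (i q) : HullQuotient (B q)) + β q (x (q + 1)) = 0 :=
      fun q => congrFun (congrArg Prod.snd h1) q
    -- `α` vanishes on the cocycle $x_q$, so its class is zero.
    have h5 : ∀ q, ∃ y, shift d y q = x q := fun q => by
      refine (hπ' q ⟨x q, hx q⟩).1 (toDivisibleHull_injective _ ?_)
      rw [← hα' q _ (hx q), h3, map_zero]
    choose y hy using h5
    -- A primitive of $x_{q+1}$ is determined up to cocycles. The defect of the equation for `i q`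
    -- lies in `B q`, hence is the class of a cocycle, which corrects the primitive.
    have h6 : ∀ q, ∃ z : X q, d q z = -x (q + 1) ∧ i q = α q z := fun q => by
      have h7 : d q (y (q + 1) q) = x (q + 1) := hy (q + 1)
      have h8 : (QuotientAddGroup.mk (i q + α q (y (q + 1) q)) : HullQuotient (B q)) = 0 := by
        rw [QuotientAddGroup.mk_add, ← hβ', h7, h4]
      obtain ⟨b, hb⟩ := (QuotientAddGroup.eq_zero_iff _).1 h8
      obtain ⟨z, rfl⟩ := hπ q b
      refine ⟨z - y (q + 1) q, ?_, ?_⟩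
      · rw [map_sub, h7, show d q (z : X q) = 0 from z.2, zero_sub]
      · rw [map_sub, show α q (z : X q) = _ from hα q z]
        exact eq_sub_of_add_eq hb.symm
    choose z hz hz' using h6
    choose k hk using fun q => QuotientAddGroup.mk_surjective (j q - β q (z (q + 1)))
    refine ⟨(k, 0), z, ?_, ?_⟩
    · refine Prod.ext (funext fun q => ?_) (funext fun q => ?_)
      · exact (hz' q).trans (zero_add _).symm
      · show j q = QuotientAddGroup.mk (k q) + β q (z (q + 1))
        rw [hk, sub_add_cancel]
    · funext q
      cases q with
      | zero =>
        rw [← hy 0]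
        exact neg_zero.symm
      | succ q => exact (neg_eq_iff_eq_neg.2 (hz q)).symm
  have hg : (zeroComplex B).IsQuasiIso (resolution B) g := by
    rintro ⟨i, j⟩ x h1 -
    have h3 : ∀ q, x q = 0 := fun q => by
      refine toDivisibleHull_injective _ ?_
      simpa [resolution, g] using congrFun (congrArg Prod.fst h1) q
    have h4 : ∀ q, (QuotientAddGroup.mk (i q) : HullQuotient (B q)) = 0 := fun q => by
      simpa [resolution, g] using congrFun (congrArg Prod.snd h1) q
    choose b hb using fun q => (QuotientAddGroup.eq_zero_iff _).1 (h4 q)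
    choose k hk using fun q => QuotientAddGroup.mk_surjective (j q)
    refine ⟨(k, 0), b, ?_, ?_⟩
    · refine Prod.ext (funext fun q => ?_) (funext fun q => ?_)
      · exact (hb q).symm.trans (zero_add _).symm
      · exact (hk q).symm.trans (add_zero _).symm
    · funext q
      rw [h3]
      cases q <;> exact neg_zero.symm
  obtain ⟨e₁⟩ := hf.nonempty_cochains_equiv (fun x => Prod.ext (funext fun q => hαd x q)
    (funext fun q => hβ' q (x q))) (fun n x => by
      refine Prod.ext (funext fun q => ?_) (funext fun q => ?_)
      · simp only [f, resolution, ofComplex, AddMonoidHom.mk'_apply, component_apply]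
        split_ifs <;> simp
      · simp only [f, resolution, ofComplex, AddMonoidHom.mk'_apply, component_apply]
        split_ifs <;> simp) hc n
  obtain ⟨e₂⟩ := hg.nonempty_cochains_equiv (fun x => by
      refine Prod.ext (funext fun q => ?_) (funext fun q => ?_)
      · cases q <;> exact map_zero _
      · have h : (QuotientAddGroup.mk (toDivisibleHull (B q) (x q)) : HullQuotient (B q)) = 0 :=
          (QuotientAddGroup.eq_zero_iff _).2 ⟨x q, rfl⟩
        exact h.symm) (fun n x => by
      refine Prod.ext (funext fun q => ?_) (funext fun q => ?_)
      · simp only [g, resolution, ofComplex, AddMonoidHom.mk'_apply, component_apply]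
        split_ifs <;> simp
      · simp only [g, resolution, AddMonoidHom.mk'_apply]
        split_ifs <;> rfl) hc n
  exact ⟨e₁.trans e₂.symm⟩

end Formality

/-! ### Words -/

section Words

variable {M N : Type*} [Monoid M] [Monoid N] {n : ℕ}

/-- The entry with index `k` of the tuple `g`, and `1` if there is none. -/
def entry (g : Fin n → M) (k : ℕ) : M := if h : k < n then g ⟨k, h⟩ else 1

/-- The product of the entries `g i, …, g (j - 1)`. -/
def word (g : Fin n → M) (i j : ℕ) : M := ((List.range' i (j - i)).map (entry g)).prod

lemma entry_val (g : Fin n → M) (k : Fin n) : entry g k = g k := dif_pos k.2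

lemma word_self (g : Fin n → M) (i : ℕ) : word g i i = 1 := by simp [word]

lemma word_succ (g : Fin n → M) (k : ℕ) : word g k (k + 1) = entry g k := by simp [word]

lemma word_mul (g : Fin n → M) {i j k : ℕ} (hij : i ≤ j) (hjk : j ≤ k) :
    word g i j * word g j k = word g i k := by
  have h : List.range' i (j - i) ++ List.range' j (k - j) = List.range' i (k - i) := by
    have := List.range'_append_1 (s := i) (m := j - i) (n := k - j)
    rwa [show i + (j - i) = j by omega, show j - i + (k - j) = k - i by omega] at this
  rw [word, word, word, ← h, List.map_append, List.prod_append]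

lemma map_word (φ : M →* N) (g : Fin n → M) (i j : ℕ) :
    φ (word g i j) = word (fun k => φ (g k)) i j := by
  rw [word, word, map_list_prod, List.map_map]
  congr 2
  funext k
  simp only [Function.comp, entry]
  split_ifs <;> simp

/-- The map between powers of a monoid that is induced by a map of simplices. -/
def pullback (α : ℕ → ℕ) (m : ℕ) (g : Fin n → M) : Fin m → M :=
  fun k => word g (α k) (α (k + 1))

/-- A tuple is a functor from $[n]$ to the one-object category of `M`, with `word g i j` the image
of $i\to j$. Pullback is composition with a monotone map, and consecutive words concatenate. -/
lemma word_pullback {α : ℕ → ℕ} {m : ℕ} (hα : ∀ i j, i ≤ j → j ≤ m → α i ≤ α j) (g : Fin n → M)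
    {i j : ℕ} (hij : i ≤ j) (hj : j ≤ m) : word (pullback α m g) i j = word g (α i) (α j) := by
  induction j, hij using Nat.le_induction with
  | base => rw [word_self, word_self]
  | succ j hij ih =>
    rw [← word_mul _ hij j.le_succ, ih (by omega), word_succ,
      ← word_mul g (hα i j hij (by omega)) (hα j (j + 1) j.le_succ hj)]
    congr 1
    exact dif_pos hj

lemma pullback_pullback {m m' : ℕ} {α α' : ℕ → ℕ} (hα : IsSimplexMap m m' α)
    (hα' : ∀ i j, i ≤ j → j ≤ m' → α' i ≤ α' j) (g : Fin n → M) :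
    pullback α m (pullback α' m' g) = pullback (fun k => α' (α k)) m g :=
  funext fun k => word_pullback hα' g (hα.mono _ _ (Nat.le_succ _) k.2) (hα.le _ k.2)

lemma pullback_congr {m : ℕ} {α α' : ℕ → ℕ} (h : ∀ k ≤ m, α k = α' k) (g : Fin n → M) :
    pullback α m g = pullback α' m g := funext fun k => by
  rw [pullback, pullback, h k k.2.le, h (k + 1) k.2]

lemma pullback_eq_self {α : ℕ → ℕ} (h : ∀ k ≤ n, α k = k) (g : Fin n → M) :
    pullback α n g = g := funext fun k => by
  rw [pullback, h k k.2.le, h (k + 1) k.2, word_succ, entry_val]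

lemma pullback_coface_zero (g : Fin (n + 1) → M) :
    pullback (coface 0) n g = fun k => g k.succ := funext fun k => by
  simp only [pullback, coface, Nat.not_lt_zero, if_false, word_succ]
  exact entry_val g k.succ

/-- An inner coface multiplies two neighbouring entries. For `j = n` no index `k` reaches `j`, and
both sides drop the last entry. -/
lemma pullback_coface_succ (j : ℕ) (g : Fin (n + 1) → M) (hj : j < n + 1) :
    pullback (coface (j + 1)) n g = Fin.contractNth ⟨j, hj⟩ (· * ·) g := funext fun k => by
  simp only [pullback, coface, Fin.contractNth]
  rcases lt_trichotomy (k : ℕ) j with h | h | h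
  · rw [if_pos (by omega), if_pos (by omega), if_pos h, word_succ]
    exact entry_val g k.castSucc
  · rw [if_pos (by omega), if_neg (by omega), if_neg (by omega), if_pos h,
      ← word_mul g (Nat.le_succ _) (Nat.le_succ _), word_succ, word_succ]
    exact congrArg₂ _ (entry_val g k.castSucc) (entry_val g k.succ)
  · rw [if_neg (by omega), if_neg (by omega), if_neg (by omega), if_neg (by omega), word_succ]
    exact entry_val g k.succ

/-- The faces of the nerve of a monoid. -/
def nerveFace (M : Type*) [Monoid M] (p i : ℕ) (g : Fin (p + 1) → M) : Fin p → M :=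
  pullback (coface i) p g

lemma isSimplicial_nerveFace (M : Type*) [Monoid M] :
    IsSimplicial (S := fun p => Fin p → M) (nerveFace M) := by
  intro p i j hij hj s
  simp only [nerveFace]
  rw [pullback_pullback (isSimplexMap_coface i le_rfl) (isSimplexMap_coface _ le_rfl).mono,
    pullback_pullback (isSimplexMap_coface j le_rfl) (isSimplexMap_coface _ le_rfl).mono]
  refine pullback_congr (fun k hk => ?_) s
  simp only [coface]
  split_ifs <;> omega

end Words

/-! ### The cosimplicial group of inhomogeneous cochains -/

section Cochains

variable {M : Type*} [Monoid M] {B : Type*} [AddCommGroup B] (ρ : M →* AddMonoid.End B)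

/-- The map of inhomogeneous cochains that is induced by a map of simplices. -/
def cochainMap (α : ℕ → ℕ) (m n : ℕ) : ((Fin m → M) → B) →+ ((Fin n → M) → B) :=
  AddMonoidHom.mk' (fun f g => ρ (word g 0 (α 0)) (f (pullback α m g))) fun f f' => by
    funext g
    simp

lemma cochainMap_apply (α : ℕ → ℕ) (m n : ℕ) (f : (Fin m → M) → B) (g : Fin n → M) :
    cochainMap ρ α m n f g = ρ (word g 0 (α 0)) (f (pullback α m g)) := rfl

/-- The twists multiply: the word from $0$ to $\alpha'(0)$ followed by the word from $\alpha'(0)$ to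
$\alpha'(\alpha(0))$. -/
lemma cochainMap_cochainMap {m m' n : ℕ} {α α' α'' : ℕ → ℕ} (hα : IsSimplexMap m m' α)
    (hα' : ∀ i j, i ≤ j → j ≤ m' → α' i ≤ α' j) (h : ∀ k ≤ m, α' (α k) = α'' k)
    (f : (Fin m → M) → B) :
    cochainMap ρ α' m' n (cochainMap ρ α m m' f) = cochainMap ρ α'' m n f := by
  funext g
  have h0 := hα.le 0 (Nat.zero_le _)
  have hmul : ∀ a b x, ρ a (ρ b x) = ρ (a * b) x := fun a b x => by
    rw [map_mul]
    rfl
  rw [cochainMap_apply, cochainMap_apply, cochainMap_apply, hmul,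
    word_pullback hα' g (Nat.zero_le _) h0,
    word_mul g (Nat.zero_le _) (hα' _ _ (Nat.zero_le _) h0), pullback_pullback hα hα',
    pullback_congr h, h 0 (Nat.zero_le _)]

lemma cochainMap_eq_self {n : ℕ} {α : ℕ → ℕ} (h : ∀ k ≤ n, α k = k) (f : (Fin n → M) → B) :
    cochainMap ρ α n n f = f := by
  funext g
  rw [cochainMap_apply, pullback_eq_self h, h 0 (Nat.zero_le _), word_self, map_one]
  rfl

/-- Only the coface 0 moves the vertex 0, so it alone contributes an action of `M`, namely by the
first entry. -/
lemma coboundary_eq_altSum (n : ℕ) :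
    coboundary ρ n = altSum (n + 2) fun i => cochainMap ρ (coface i) n (n + 1) := by
  ext f g
  rw [altSum_apply, Finset.sum_range_succ', Pi.add_apply, Finset.sum_apply]
  refine Eq.trans ?_ (add_comm _ _)
  show ρ (g 0) (f fun i => g i.succ) + _ = _
  congr 1
  · rw [pow_zero, one_smul, cochainMap_apply, pullback_coface_zero,
      show word g 0 (coface 0 0) = g 0 from (word_succ g 0).trans (entry_val g 0)]
  · rw [← Fin.sum_univ_eq_sum_range
      (fun i => ((-1 : ℤ) ^ (i + 1) • cochainMap ρ (coface (i + 1)) n (n + 1) f) g)]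
    refine Finset.sum_congr rfl fun j _ => ?_
    rw [Pi.smul_apply, cochainMap_apply, pullback_coface_succ j g j.2,
      show word g 0 (coface (j + 1) 0) = 1 by simp [coface, word_self], map_one]
    rfl

/-- The cohomology of a complex of inhomogeneous cochains can be computed from an isomorphic
complex. -/
theorem nonempty_ofComplex_equiv (K : ∀ n : ℕ, AddSubgroup ((Fin n → M) → B)) {L : ℕ → Type*}
    [∀ n, AddCommGroup (L n)] (e : ∀ n, L n →+ L (n + 1)) (he : ∀ n x, e (n + 1) (e n x) = 0)
    (Φ : ∀ n, L n →+ ((Fin n → M) → B)) (hΦ : ∀ n, Function.Injective (Φ n))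
    (hK : ∀ n f, f ∈ K n ↔ ∃ l, Φ n l = f)
    (hd : ∀ n l, coboundary ρ n (Φ n l) = Φ (n + 1) (e n l)) (n : ℕ) :
    Nonempty ((ofComplex e he).H n ≃+ CochainCohomology ρ K n) := by
  have hsingle : ∀ n l, shift e (Pi.single n l) = Pi.single (n + 1) (e n l) := by
    intro n l
    funext p
    cases p with
    | zero => simp
    | succ p =>
      rw [shift_succ]
      by_cases h : p = n
      · subst h
        simp
      · rw [Pi.single_eq_of_ne h, Pi.single_eq_of_ne (by omega), map_zero]
  refine nonempty_subquotient_equiv ((Φ n).comp (Pi.evalAddMonoidHom L n)) ?_ ?_ ?_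
  · rintro x ⟨h1, -⟩
    refine ⟨(hK n _).2 ⟨x n, rfl⟩, (hd n (x n)).trans ?_⟩
    rw [show e n (x n) = 0 from congrFun h1 (n + 1), map_zero]
  · rintro x ⟨h1, h2⟩
    have h2 : ∀ p, p ≠ n → x p = 0 := component_eq_self_iff.1 h2
    cases n with
    | zero =>
      constructor
      · intro h
        refine ⟨0, ?_⟩
        rw [map_zero]
        funext p
        by_cases hp : p = 0
        · subst hp
          exact (hΦ 0 ((map_zero _).trans h.symm))
        · exact (h2 p hp).symm
      · rintro ⟨y, rfl⟩
        exact map_zero (Φ 0)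
    | succ n =>
      constructor
      · rintro ⟨g, hg, h⟩
        obtain ⟨l, rfl⟩ := (hK n g).1 hg
        rw [hd] at h
        refine ⟨Pi.single n l, (hsingle n l).trans ?_⟩
        funext p
        by_cases hp : p = n + 1
        · subst hp
          rw [Pi.single_eq_same]
          exact hΦ _ h
        · rw [Pi.single_eq_of_ne hp, h2 p hp]
      · rintro ⟨y, rfl⟩
        exact ⟨Φ n (y n), (hK n _).2 ⟨_, rfl⟩, hd n (y n)⟩
  · rintro f ⟨h1, h2⟩
    obtain ⟨l, rfl⟩ := (hK n f).1 h1
    have h2 : coboundary ρ n (Φ n l) = 0 := h2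
    rw [hd] at h2
    have h2 : e n l = 0 := hΦ _ (h2.trans (map_zero _).symm)
    refine ⟨Pi.single n l, ⟨?_, ?_⟩, ?_⟩
    · refine (hsingle n l).trans ?_
      rw [h2, Pi.single_zero]
    · exact component_eq_self_iff.2 fun p hp => Pi.single_eq_of_ne hp _
    · simp

end Cochains

/-! ### Bicosimplicial groups of cochains -/

section Bicochains

variable {M : Type*} [Monoid M] {B : Type*} [AddCommGroup B] {ρ : M →* AddMonoid.End B}
  {K : ∀ n : ℕ, AddSubgroup ((Fin n → M) → B)}
  (hK : ∀ (α : ℕ → ℕ) (m n : ℕ), ∀ f ∈ K m, cochainMap ρ α m n f ∈ K n)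

/-- The restriction of `cochainMap` to admissible cochains. -/
def admissibleMap (α : ℕ → ℕ) (m n : ℕ) : K m →+ K n :=
  ((cochainMap ρ α m n).comp (K m).subtype).codRestrict (K n) fun f => hK α m n f f.2

/-- The coboundary on admissible cochains. -/
def admissibleD (n : ℕ) : K n →+ K (n + 1) :=
  altSum (n + 2) fun i => admissibleMap hK (coface i) n (n + 1)

lemma coe_admissibleD (n : ℕ) (f : K n) : (admissibleD hK n f : (Fin (n + 1) → M) → B) =
    coboundary ρ n f := by
  rw [coboundary_eq_altSum]
  exact map_altSum (n + 2) (f' := fun i => cochainMap ρ (coface i) n (n + 1))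
    (K (n + 1)).subtype f (f : (Fin n → M) → B) fun _ _ => rfl

variable (D : Type*) [Monoid D]

/-- The bicosimplicial group of functions on powers of `D` with values in cochains of `M`. -/
def bicochains : Bicosimplicial fun m n => (Fin m → D) → K n where
  map {m n m' n'} α β := AddMonoidHom.mk' (fun z s => admissibleMap hK β n n' (z (pullback α m s)))
    fun z z' => by
      funext s
      simp
  map_eq_self α β z ha hb := by
    funext s
    refine Subtype.ext ?_
    rw [AddMonoidHom.mk'_apply, pullback_eq_self ha]
    exact cochainMap_eq_self ρ hb _
  map_map {m n m' n' m'' n''} {α α' α'' β β' β''} z h1 h2 h3 h4 ha hb := by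
    funext s
    refine Subtype.ext ?_
    simp only [AddMonoidHom.mk'_apply]
    rw [pullback_pullback h1 h2.mono, pullback_congr ha]
    exact cochainMap_cochainMap ρ h3 h4.mono hb _

lemma bicochains_map_apply {m n m' n' : ℕ} (α β : ℕ → ℕ) (z : (Fin m → D) → K n)
    (s : Fin m' → D) : ((bicochains hK D).map α β z : (Fin m' → D) → K n') s =
      admissibleMap hK β n n' (z (pullback α m s)) := rfl

lemma admissibleD_admissibleD (n : ℕ) (f : K n) :
    admissibleD hK (n + 1) (admissibleD hK n f) = 0 := by
  refine Subtype.ext ?_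
  rw [coe_admissibleD, coe_admissibleD, coboundary_eq_altSum, coboundary_eq_altSum, altSum_altSum]
  refine sum_cosimplicial_eq_zero (n + 1) _ fun i j hij hj => ?_
  rw [cochainMap_cochainMap ρ (isSimplexMap_coface i le_rfl) (isSimplexMap_coface _ le_rfl).mono
      fun _ _ => rfl,
    cochainMap_cochainMap ρ (isSimplexMap_coface j le_rfl) (isSimplexMap_coface _ le_rfl).mono
      fun k hk => ?_]
  simp only [coface]
  split_ifs <;> omega

lemma bicochains_verD (p q : ℕ) (z : (Fin p → D) → K q) (s : Fin p → D) :
    (bicochains hK D).verD p q z s = admissibleD hK q (z s) := by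
  refine map_altSum (q + 2) (Pi.evalAddMonoidHom (fun _ : Fin p → D => K (q + 1)) s) z (z s)
    fun j _ => ?_
  show admissibleMap hK _ _ _ (z (pullback id p s)) = _
  rw [pullback_eq_self (α := id) fun _ _ => rfl]

lemma bicochains_horD (p q : ℕ) (z : (Fin p → D) → K q) :
    (bicochains hK D).horD p q z = faceD (S := fun p => Fin p → D) (nerveFace D) (K q) p z := by
  refine map_altSum (p + 2) (AddMonoidHom.id _) z z fun j _ => funext fun s => Subtype.ext ?_
  exact cochainMap_eq_self ρ (fun _ _ => rfl) _

/-- The total complex of bicochains consists of the cochains of `D` with values in the complex of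
cochains of `M`. -/
theorem nonempty_cochains_equiv_tot (n : ℕ) :
    Nonempty (((ofComplex (admissibleD hK) (admissibleD_admissibleD hK)).cochains
      (isSimplicial_nerveFace D)).H n ≃+ (bicochains hK D).tot.H n) := by
  let f : (∀ p, (Fin p → D) → ∀ q, K q) →+ ∀ p q, (Fin p → D) → K q :=
    AddMonoidHom.mk' (fun x p q s => x p s q) fun _ _ => rfl
  have hf : Function.Bijective f :=
    ⟨fun x y h => funext fun p => funext fun s => funext fun q =>
        congrFun (congrFun (congrFun h p) q) s,
      fun y => ⟨fun p s q => y p q s, rfl⟩⟩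
  have hd : ∀ x, f (((ofComplex (admissibleD hK) (admissibleD_admissibleD hK)).cochains
      (isSimplicial_nerveFace D)).d x) = (bicochains hK D).tot.d (f x) := by
    intro x
    funext p q s
    have h1 : shift (admissibleD hK) (x p s) q =
        shift ((bicochains hK D).verD p) (fun q s => x p s q) q s := by
      cases q with
      | zero => rfl
      | succ q => exact (bicochains_verD hK D p q (fun s => x p s q) s).symm
    have h2 : shift (fun p => faceD (S := fun p => Fin p → D) (nerveFace D) (∀ q, K q) p) x p s q =
        shift (R := fun p => ∀ q, (Fin p → D) → K q)
          (fun p => totalMap fun q => (bicochains hK D).horD p q) (fun p q s => x p s q) p q s := by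
      cases p with
      | zero => rfl
      | succ p =>
        rw [shift_succ, shift_succ, totalMap_apply, bicochains_horD]
        exact congrFun (mapCoeff_faceD (S :=
            fun p => Fin p → D) (nerveFace D) (Pi.evalAddMonoidHom (fun q => K q) q) p (x p)) s
    exact congrArg₂ (fun a b => (-1 : ℤ) ^ p • a + b) h1 h2
  refine (GradedDifferential.isQuasiIso_of_bijective hf hd).nonempty_equiv hd (fun n x => ?_) n
  funext p q s
  show ((ofComplex (admissibleD hK) (admissibleD_admissibleD hK)).cochains
      (isSimplicial_nerveFace D)).proj n x p s q = _
  rw [GradedDifferential.cochains_proj_apply, Bicosimplicial.tot, total_proj_apply]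
  by_cases h : p ≤ n
  · rw [if_pos h, if_pos h]
    show component _ (n - p) (x p s) q = component _ (n - p) (f x p) q s
    rw [component_apply, component_apply]
    split_ifs <;> rfl
  · rw [if_neg h, if_neg h]
    rfl

/-- The class of an admissible cocycle. -/
def classMap (n : ℕ) : (admissibleD hK n).ker →+ CochainCohomology ρ K n :=
  (QuotientAddGroup.mk' _).comp
    (((K n).subtype.comp (admissibleD hK n).ker.subtype).codRestrict (cocycles ρ K n) fun z =>
      ⟨z.1.2, by
        have h := congrArg Subtype.val (show admissibleD hK n z.1 = 0 from z.2)
        rwa [coe_admissibleD] at h⟩)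

lemma classMap_surjective (n : ℕ) : Function.Surjective (classMap hK n) := by
  intro y
  induction y using QuotientAddGroup.induction_on with
  | H y => exact ⟨⟨⟨y.1, y.2.1⟩, Subtype.ext ((coe_admissibleD hK n _).trans y.2.2)⟩, rfl⟩

lemma classMap_eq_zero_iff (n : ℕ) (z : (admissibleD hK n).ker) :
    classMap hK n z = 0 ↔ ∃ y, shift (admissibleD hK) y n = z := by
  refine (QuotientAddGroup.eq_zero_iff _).trans ?_
  rw [AddSubgroup.mem_addSubgroupOf]
  show ((z : K n) : (Fin n → M) → B) ∈ coboundaries ρ K n ↔ _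
  cases n with
  | zero =>
    constructor
    · intro h
      exact ⟨0, Subtype.ext (Eq.symm h)⟩
    · rintro ⟨y, h⟩
      rw [← h]
      exact zero_mem _
  | succ n =>
    constructor
    · rintro ⟨g, hg, h⟩
      refine ⟨Pi.single n ⟨g, hg⟩, Subtype.ext ?_⟩
      rw [shift_succ, Pi.single_eq_same, coe_admissibleD]
      exact h
    · rintro ⟨y, h⟩
      refine ⟨y n, (y n).2, ?_⟩
      rw [← h, shift_succ, coe_admissibleD]

end Bicochains

/-! ### Coefficients with trivial action -/

section Trivial

variable {D : Type*} [Monoid D]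

/-- With trivial action the twist disappears, and inhomogeneous cochains are plain cochains on the
nerve. -/
lemma coboundary_of_trivial {B : Type*} [AddCommGroup B] {τ : D →* AddMonoid.End B}
    (hτ : ∀ d b, τ d b = b) (n : ℕ) (f : (Fin n → D) → B) :
    coboundary τ n f = faceD (S := fun p => Fin p → D) (nerveFace D) B n f := by
  rw [coboundary_eq_altSum]
  exact map_altSum (n + 2) (AddMonoidHom.id _) f f fun i _ => funext fun s => hτ _ _

variable {B : ℕ → Type*} [∀ q, AddCommGroup (B q)] {τ : ∀ q, D →* AddMonoid.End (B q)}

lemma faceD_apply_apply (p : ℕ) (x : (Fin p → D) → ∀ q, B q) (s : Fin (p + 1) → D) (q : ℕ) :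
    faceD (S := fun p => Fin p → D) (nerveFace D) (∀ q, B q) p x s q =
      faceD (S := fun p => Fin p → D) (nerveFace D) (B q) p (fun s => x s q) s :=
  congrFun (mapCoeff_faceD (S := fun p => Fin p → D) (nerveFace D) (Pi.evalAddMonoidHom B q) p x) s

lemma zeroComplex_cochains_d (x : ∀ p, (Fin p → D) → ∀ q, B q) :
    ((zeroComplex B).cochains (isSimplicial_nerveFace D)).d x =
      shift (fun p => faceD (S := fun p => Fin p → D) (nerveFace D) (∀ q, B q) p) x := by
  funext p
  rw [GradedDifferential.cochains_d_apply]
  have h : mapCoeff (Fin p → D) (zeroComplex B).d (x p) = 0 := funext fun s => funext fun q => by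
    cases q <;> rfl
  rw [h, smul_zero, zero_add]

lemma zeroComplex_cochains_proj_eq_self_iff (n : ℕ) (x : ∀ p, (Fin p → D) → ∀ q, B q) :
    ((zeroComplex B).cochains (isSimplicial_nerveFace D)).proj n x = x ↔
      ∀ p s q, p + q ≠ n → x p s q = 0 := by
  constructor
  · intro h p s q hpq
    rw [← h, GradedDifferential.cochains_proj_apply]
    split_ifs with hp
    · exact if_neg (by omega)
    · rfl
  · intro h
    funext p s q
    rw [GradedDifferential.cochains_proj_apply]
    split_ifs with hp
    · show component B (n - p) (x p s) q = _
      rw [component_apply]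
      split_ifs with hq
      · rfl
      · exact (h p s q (by omega)).symm
    · exact (h p s q (by omega)).symm

/-- The total complex of cochains with values in a complex with differential zero. -/
theorem nonempty_cochains_equiv_directSum (hτ : ∀ q d b, τ q d b = b) (n : ℕ) :
    Nonempty (((zeroComplex B).cochains (isSimplicial_nerveFace D)).H n ≃+
      ⨁ pq : Finset.HasAntidiagonal.antidiagonal n, MonoidCohomology (τ pq.1.2) pq.1.1) := by
  set 𝒯 := (zeroComplex B).cochains (isSimplicial_nerveFace D) with h𝒯
  have hmem : ∀ x, x ∈ 𝒯.homogeneousCocycles n ↔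
      (∀ p, faceD (S := fun p => Fin p → D) (nerveFace D) (∀ q, B q) p (x p) = 0) ∧
        ∀ p s q, p + q ≠ n → x p s q = 0 := by
    intro x
    refine and_congr ?_ (zeroComplex_cochains_proj_eq_self_iff n x)
    rw [h𝒯, zeroComplex_cochains_d]
    constructor
    · exact fun h p => congrFun h (p + 1)
    · intro h
      funext p
      cases p with
      | zero => rfl
      | succ p => exact h p
  let entryMap : ∀ p q, (∀ p, (Fin p → D) → ∀ q, B q) →+ ((Fin p → D) → B q) := fun p q =>
    AddMonoidHom.mk' (fun x s => x p s q) fun _ _ => rfl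
  have hentry : ∀ p q, ∀ x ∈ 𝒯.homogeneousCocycles n,
      entryMap p q x ∈ cocycles (τ q) (fun _ => ⊤) p := by
    intro p q x hx
    refine ⟨trivial, (coboundary_of_trivial (hτ q) p _).trans (funext fun s => ?_)⟩
    exact (faceD_apply_apply p (x p) s q).symm.trans
      (congrFun (congrFun (((hmem x).1 hx).1 p) s) q)
  -- With zero differential on the coefficients, a total cocycle of degree `n` is a family of
  -- independent cocycles, one for each $p+q=n$. `F` takes their classes.
  let F : 𝒯.homogeneousCocycles n →+
      ∀ pq : Finset.HasAntidiagonal.antidiagonal n, MonoidCohomology (τ pq.1.2) pq.1.1 :=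
    AddMonoidHom.pi fun pq => (QuotientAddGroup.mk' _).comp
      (((entryMap pq.1.1 pq.1.2).comp (𝒯.homogeneousCocycles n).subtype).codRestrict
        (cocycles (τ pq.1.2) (fun _ => ⊤) pq.1.1) fun x => hentry _ _ x x.2)
  have hF0 : ∀ x pq, F x pq = 0 ↔
      entryMap pq.1.1 pq.1.2 x ∈ coboundaries (τ pq.1.2) (fun _ => ⊤) pq.1.1 := fun x pq =>
    (QuotientAddGroup.eq_zero_iff _).trans AddSubgroup.mem_addSubgroupOf
  have hF : Function.Surjective F := by
    intro v
    have hv : ∀ pq : Finset.HasAntidiagonal.antidiagonal n,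
        ∃ z : cocycles (τ pq.1.2) (fun _ => ⊤) pq.1.1, QuotientAddGroup.mk z = v pq := fun pq =>
      QuotientAddGroup.mk_surjective (v pq)
    choose z hz using hv
    let x : ∀ p, (Fin p → D) → ∀ q, B q := fun p s q =>
      if h : p + q = n then (z ⟨(p, q), Finset.HasAntidiagonal.mem_antidiagonal.2 h⟩).1 s else 0
    have hx : ∀ p q (h : p + q = n),
        (fun s => x p s q) = (z ⟨(p, q), Finset.HasAntidiagonal.mem_antidiagonal.2 h⟩).1 :=
            fun p q h =>
      funext fun s => dif_pos h
    have hx' : ∀ p q, p + q ≠ n → (fun s => x p s q) = 0 := fun p q h =>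
      funext fun s => dif_neg h
    refine ⟨⟨x, (hmem x).2 ⟨fun p => funext fun s => funext fun q => ?_,
      fun p s q h => dif_neg h⟩⟩, funext fun pq => ?_⟩
    · rw [faceD_apply_apply]
      by_cases h : p + q = n
      · rw [hx p q h, ← coboundary_of_trivial (hτ q)]
        exact congrFun (z ⟨(p, q), Finset.HasAntidiagonal.mem_antidiagonal.2 h⟩).2.2 s
      · rw [hx' p q h, map_zero]
        rfl
    · refine Eq.trans ?_ (hz pq)
      exact congrArg QuotientAddGroup.mk
        (Subtype.ext (hx pq.1.1 pq.1.2 (Finset.HasAntidiagonal.mem_antidiagonal.1 pq.2)))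
  have hker : F.ker = (𝒯.d.range).addSubgroupOf (𝒯.homogeneousCocycles n) := by
    ext x
    rw [AddMonoidHom.mem_ker, AddSubgroup.mem_addSubgroupOf]
    obtain ⟨-, hx⟩ := (hmem x).1 x.2
    constructor
    · intro h
      have hb : ∀ p q (h : p + q = n),
          (fun s => x.1 p s q) ∈ coboundaries (τ q) (fun _ => ⊤) p := fun p q hpq =>
        (hF0 x ⟨(p, q), Finset.HasAntidiagonal.mem_antidiagonal.2 hpq⟩).1 (congrFun h _)
      -- Off the antidiagonal the component of `x` vanishes and 0 is a primitive.
      have hy : ∀ p q, ∃ g, faceD (S := fun p => Fin p → D) (nerveFace D) (B q) p g =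
          fun s => x.1 (p + 1) s q := by
        intro p q
        by_cases hpq : p + 1 + q = n
        · obtain ⟨g, -, hg⟩ := hb (p + 1) q hpq
          exact ⟨g, (coboundary_of_trivial (hτ q) p g).symm.trans hg⟩
        · exact ⟨0, (map_zero _).trans (funext fun s => (hx _ _ _ hpq).symm)⟩
      choose y hy using hy
      refine ⟨fun p s q => y p q s, (zeroComplex_cochains_d _).trans (funext fun p => ?_)⟩
      cases p with
      | zero =>
        funext s q
        by_cases hq : 0 + q = n
        · exact (congrFun (show (fun s => x.1 0 s q) = 0 from hb 0 q hq) s).symm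
        · exact (hx _ _ _ hq).symm
      | succ p =>
        funext s q
        rw [shift_succ, faceD_apply_apply]
        exact congrFun (hy p q) s
    · rintro ⟨y, hy⟩
      have hy := (zeroComplex_cochains_d y).symm.trans hy
      funext pq
      refine (hF0 x pq).2 ?_
      obtain ⟨⟨p, q⟩, hpq⟩ := pq
      show (fun s => x.1 p s q) ∈ coboundaries (τ q) (fun _ => ⊤) p
      rw [← show _ = x.1 from hy]
      cases p with
      | zero => exact zero_mem _
      | succ p =>
        refine ⟨fun s => y p s q, trivial, (coboundary_of_trivial (hτ q) p _).trans ?_⟩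
        exact funext fun s => (faceD_apply_apply p (y p) s q).symm
  exact ⟨((QuotientAddGroup.quotientAddEquivOfEq hker.symm).trans
    (QuotientAddGroup.quotientKerEquivOfSurjective F hF)).trans
      (DirectSum.addEquivProd _).symm⟩

end Trivial

/-! ### Rigidified modules -/

namespace DiscreteObjects

variable {C : Type u} [Category.{v} C] [CartesianMonoidalCategory C] [HasFiniteLimits C]
  {T : DiscreteObjects.{w} C}

/-- The evaluation of morphisms to a topologised monoid at a point. -/
def evalHom (T : DiscreteObjects.{w} C) {Y G : C} [MonObj G] (y : T.forget.obj Y) :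
    (Y ⟶ G) →* T.forget.obj G where
  toFun φ := T.forget.map φ y
  map_one' := by
    apply (T.elt G).injective
    rw [elt_naturality, elt_one]
    exact MonObj.comp_one _
  map_mul' φ ψ := by
    apply (T.elt G).injective
    rw [elt_naturality, elt_mul, elt_naturality, elt_naturality]
    exact MonObj.comp_mul _ _ _

/-- Points of an object are morphisms from the free object on a singleton, and these are determined
by their two projections. -/
lemma forget_prod_ext {X Y : C} {x y : T.forget.obj (X ⊗ Y)}
    (h1 : T.forget.map (fst X Y) x = T.forget.map (fst X Y) y)
    (h2 : T.forget.map (snd X Y) x = T.forget.map (snd X Y) y) : x = y := by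
  apply (T.elt _).injective
  apply CartesianMonoidalCategory.hom_ext
  · rw [← elt_naturality, ← elt_naturality, h1]
  · rw [← elt_naturality, ← elt_naturality, h2]

lemma forget_map_lift_fst {X Y W : C} (f : W ⟶ X) (g : W ⟶ Y) (z : T.forget.obj W) :
    T.forget.map (fst X Y) (T.forget.map (lift f g) z) = T.forget.map f z := by
  rw [← Functor.map_comp_apply, lift_fst]

lemma forget_map_lift_snd {X Y W : C} (f : W ⟶ X) (g : W ⟶ Y) (z : T.forget.obj W) :
    T.forget.map (snd X Y) (T.forget.map (lift f g) z) = T.forget.map g z := by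
  rw [← Functor.map_comp_apply, lift_snd]

lemma forget_map_piLift {X W : C} {n : ℕ} (f : Fin n → (W ⟶ X)) (z : T.forget.obj W) (i : Fin n) :
    T.forget.map (Pi.π (fun _ : Fin n => X) i) (T.forget.map (Pi.lift f) z) =
      T.forget.map (f i) z := by
  rw [← Functor.map_comp_apply, Pi.lift_π]

namespace RigidModule

section

variable {G : C} [MonObj G] {A : Type t} [AddCommGroup A] (M : T.RigidModule G A)

/-- The cochains form a cosimplicial group. -/
lemma cochainMap_mem_cochains (α : ℕ → ℕ) (m n : ℕ) (f : (Fin m → T.forget.obj G) → A)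
    (hf : f ∈ M.cochains m) : cochainMap M.action α m n f ∈ M.cochains n := by
  let g : Fin n → ((∏ᶜ fun _ : Fin n => G) ⟶ G) := fun k => Pi.π (fun _ : Fin n => G) k
  have hg : ∀ i j z, T.forget.map (word g i j) z = word (fun k => T.forget.map (g k) z) i j :=
    fun i j z => map_word (T.evalHom z) g i j
  have h := M.comp_mem (lift (word g 0 (α 0)) (Pi.lift (pullback α m g))) _ (M.act_mem _ _ hf)
  refine (congrArg (· ∈ M.maps _) (funext fun z => ?_)).mp h
  simp only [forget_map_lift_fst, forget_map_lift_snd, forget_map_piLift, hg]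
  rw [cochainMap_apply]
  congr 2
  funext k
  exact hg _ _ z

end

/-! ### Pliancy for several copies of the discrete object -/

section Pliant

variable [T.IsTopological] {Y : Type t} {h : T.Rigidification Y} {D : C}

/-- Induction on `n`: pliancy absorbs one copy of `D` into `X` at a time. Allowing arbitrary
morphisms from `W` avoids any rearrangement of the factors of $(D\times G)^n$. -/
lemma _root_.TopMon.DiscreteObjects.Rigidification.IsPliant.mem_maps (hD : h.IsPliant D) (n : ℕ) :
    ∀ {X W : C} (f : (Fin n → T.forget.obj D) → T.forget.obj X → Y), (∀ d, f d ∈ h.maps X) →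
      ∀ (a : Fin n → (W ⟶ D)) (b : W ⟶ X),
        (fun z => f (fun i => T.forget.map (a i) z) (T.forget.map b z)) ∈ h.maps W := by
  induction n with
  | zero =>
    intro X W f hf a b
    have := h.comp_mem b _ (hf Fin.elim0)
    refine (congrArg (· ∈ h.maps W) (funext fun z => ?_)).mp this
    congr 1
    exact Subsingleton.elim _ _
  | succ n ih =>
    intro X W f hf a b
    have := ih (X := D ⊗ X) (W := W)
      (fun d z => f (Fin.cons (T.forget.map (fst D X) z) d) (T.forget.map (snd D X) z))
      (fun d => (hD.mem_iff X _).2 fun d₀ => by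
        simpa only [fst_slice, snd_slice] using hf (Fin.cons d₀ d))
      (fun i => a i.succ) (lift (a 0) b)
    refine (congrArg (· ∈ h.maps W) (funext fun z => ?_)).mp this
    rw [forget_map_lift_fst, forget_map_lift_snd]
    congr 2
    funext i
    refine Fin.cases rfl (fun i => rfl) i

end Pliant

/-! ### Cochains of the product as diagonal bicochains -/

section Product

variable [BraidedCategory C] {D G : C} [MonObj D] [MonObj G] {A : Type t}
  [AddCommGroup A] (M : T.RigidModule (D ⊗ G) A)

/-- A function on powers of `D` with values in cochains of `G`, as a cochain of `D ⊗ G`. -/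
def ofBicochain (n : ℕ) :
    ((Fin n → T.forget.obj D) → (M.restrict (inclRight D G)).cochains n) →+
      ((Fin n → T.forget.obj (D ⊗ G)) → A) :=
  AddMonoidHom.mk' (fun z x => (z fun i => T.forget.map (fst D G) (x i)).1
    fun i => T.forget.map (snd D G) (x i)) fun _ _ => rfl

lemma ofBicochain_apply (n : ℕ)
    (z : (Fin n → T.forget.obj D) → (M.restrict (inclRight D G)).cochains n)
    (x : Fin n → T.forget.obj (D ⊗ G)) :
    M.ofBicochain n z x = (z fun i => T.forget.map (fst D G) (x i)).1
      fun i => T.forget.map (snd D G) (x i) := rfl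

lemma ofBicochain_injective [T.IsTopological] (n : ℕ) : Function.Injective (M.ofBicochain n) := by
  intro z z' h
  funext d
  refine Subtype.ext (funext fun g => ?_)
  have := congrFun h fun i => T.forget.map (T.slice G (d i)) (g i)
  simpa only [ofBicochain_apply, fst_slice, snd_slice] using this

lemma mem_cochains_iff [T.IsTopological] (hD : M.IsPliant D) (n : ℕ) (f : (Fin n → T.forget.obj (D
    ⊗ G)) → A) :
    f ∈ M.cochains n ↔ ∃ z, M.ofBicochain n z = f := by
  constructor
  · intro hf
    refine ⟨fun d => ⟨fun g => f fun i => T.forget.map (T.slice G (d i)) (g i), ?_⟩, ?_⟩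
    -- For fixed $d\in D^n$, the slices assemble to a morphism $G^n\to(D\times G)^n$, along which
    -- `f` is restricted.
    · have := M.comp_mem
        (Pi.lift fun i => Pi.π (fun _ : Fin n => G) i ≫ T.slice G (d i)) _ hf
      refine (congrArg (· ∈ M.maps _) (funext fun z => ?_)).mp this
      refine congrArg f (funext fun i => ?_)
      rw [forget_map_piLift, Functor.map_comp_apply]
    · funext x
      refine congrArg f (funext fun i => forget_prod_ext ?_ ?_)
      · rw [fst_slice]
      · rw [snd_slice]
  · rintro ⟨z, rfl⟩
    have := hD.mem_maps n (W := ∏ᶜ fun _ : Fin n => D ⊗ G) _ (fun d => (z d).2)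
      (fun i => Pi.π (fun _ : Fin n => D ⊗ G) i ≫ fst D G)
      (Pi.lift fun i => Pi.π (fun _ : Fin n => D ⊗ G) i ≫ snd D G)
    refine (congrArg (· ∈ M.maps _) (funext fun y => ?_)).mp this
    simp only [forget_map_piLift, Functor.map_comp_apply]
    rfl

/-- Every element factors as $(d,g)=(d,1)(1,g)$, and the first factor acts trivially. -/
lemma action_of_trivial
    (htriv : ∀ (d : T.forget.obj D) (a : A), M.action (T.mapHom (inclLeft D G) d) a = a)
    (x : T.forget.obj (D ⊗ G)) (a : A) :
    M.action x a = M.action (T.mapHom (inclRight D G) (T.mapHom (snd D G) x)) a := by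
  have hx : x = T.mapHom (inclLeft D G) (T.mapHom (fst D G) x) *
      T.mapHom (inclRight D G) (T.mapHom (snd D G) x) := by
    have hone : ∀ {X Y : C} [MonObj Y] (y : T.forget.obj X),
        T.forget.map (toUnit X ≫ (η : 𝟙_ C ⟶ Y)) y = 1 := fun y => map_one (T.evalHom y)
    refine forget_prod_ext ?_ ?_
    · refine Eq.trans ?_ (map_mul (T.mapHom (fst D G)) _ _).symm
      have h1 : T.mapHom (fst D G) (T.mapHom (inclLeft D G) (T.mapHom (fst D G) x)) =
          T.mapHom (fst D G) x := by
        refine (forget_map_lift_fst _ _ _).trans ?_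
        rw [CategoryTheory.Functor.map_id]
        rfl
      have h2 : T.mapHom (fst D G) (T.mapHom (inclRight D G) (T.mapHom (snd D G) x)) = 1 :=
        (forget_map_lift_fst _ _ _).trans (hone _)
      rw [h1, h2, _root_.mul_one]
      rfl
    · refine Eq.trans ?_ (map_mul (T.mapHom (snd D G)) _ _).symm
      have h1 : T.mapHom (snd D G) (T.mapHom (inclRight D G) (T.mapHom (snd D G) x)) =
          T.mapHom (snd D G) x := by
        refine (forget_map_lift_snd _ _ _).trans ?_
        rw [CategoryTheory.Functor.map_id]
        rfl
      have h2 : T.mapHom (snd D G) (T.mapHom (inclLeft D G) (T.mapHom (fst D G) x)) = 1 :=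
        (forget_map_lift_snd _ _ _).trans (hone _)
      rw [h1, h2, _root_.one_mul]
      rfl
  conv_lhs => rw [hx, map_mul]
  exact htriv _ _

/-- Projections of $D\times G$ are homomorphisms, so pullback along a coface acts on the two
coordinates separately, by the same coface. The twist is by an element of $D\times G$; triviality of
the action of $D$ leaves only its $G$-part, which is the twist in the bicochains. -/
lemma coboundary_ofBicochain
    (htriv : ∀ (d : T.forget.obj D) (a : A), M.action (T.mapHom (inclLeft D G) d) a = a) (n : ℕ)
    (z : (Fin n → T.forget.obj D) → (M.restrict (inclRight D G)).cochains n) :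
    coboundary M.action n (M.ofBicochain n z) =
      M.ofBicochain (n + 1) ((bicochains (M.restrict (inclRight D G)).cochainMap_mem_cochains
        (T.forget.obj D)).diagD n z) := by
  rw [coboundary_eq_altSum]
  refine (map_altSum _ _ _ _ fun i _ => funext fun x => ?_).symm
  rw [cochainMap_apply, M.action_of_trivial htriv, ofBicochain_apply, ofBicochain_apply,
    bicochains_map_apply]
  have h1 : (fun k => T.forget.map (fst D G) (pullback (coface i) n x k)) =
      pullback (coface i) n fun k => T.forget.map (fst D G) (x k) :=
    funext fun k => map_word (T.mapHom (fst D G)) x _ _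
  have h2 : (fun k => T.forget.map (snd D G) (pullback (coface i) n x k)) =
      pullback (coface i) n fun k => T.forget.map (snd D G) (x k) :=
    funext fun k => map_word (T.mapHom (snd D G)) x _ _
  rw [h1, h2, map_word (T.mapHom (snd D G)) x]
  rfl

end Product

end RigidModule

end DiscreteObjects

end

end TopMon

open TopMon TopMon.DiscreteObjects.RigidModule in
theorem proposition11p17 {C : Type u} [Category.{v} C] [CartesianMonoidalCategory C]
    [BraidedCategory C] [HasFiniteLimits C]
    (T : TopMon.DiscreteObjects.{w} C) [T.IsTopological]
    (D G : C) [MonObj D] [IsCommMonObj D] [MonObj G]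
    {A : Type t} [AddCommGroup A] (M : T.RigidModule (D ⊗ G) A)
    (hD : M.IsPliant D) [Finite (T.forget.obj D)]
    (htriv : ∀ (d : T.forget.obj D) (a : A),
      M.action (T.mapHom (TopMon.DiscreteObjects.RigidModule.inclLeft D G) d) a = a)
    (n : ℕ) :
    Nonempty (M.Cohomology n ≃+
      ⨁ pq : Finset.HasAntidiagonal.antidiagonal n,
        TopMon.MonoidCohomology (M.actionOnCohomology pq.1.2) pq.1.1) := by
  have hK := (M.restrict (inclRight D G)).cochainMap_mem_cochains
  have hτ : ∀ q d b, M.actionOnCohomology q d b = b := by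
    intro q d b
    induction b using QuotientAddGroup.induction_on with
    | H f => exact congrArg QuotientAddGroup.mk (Subtype.ext (funext fun x => htriv d (f.1 x)))
  -- The chain of isomorphisms: cochains of $D\times G$, diagonal, total complex, cochains of $D$ in
  -- $X^\bullet(G,A)$, cochains of $D$ in the cohomology with zero differential, direct sum.
  obtain ⟨e₁⟩ := nonempty_ofComplex_equiv M.action M.cochains _
    (bicochains hK (T.forget.obj D)).diagD_diagD M.ofBicochain M.ofBicochain_injective
    (M.mem_cochains_iff hD) (M.coboundary_ofBicochain htriv) n
  obtain ⟨e₂⟩ := (bicochains hK (T.forget.obj D)).nonempty_diag_equiv_tot n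
  obtain ⟨e₃⟩ := nonempty_cochains_equiv_tot hK (T.forget.obj D) n
  obtain ⟨e₄⟩ := nonempty_cochains_equiv_of_cohomology (admissibleD_admissibleD hK) (classMap hK)
    (classMap_surjective hK) (classMap_eq_zero_iff hK) (isSimplicial_nerveFace (T.forget.obj D)) n
  obtain ⟨e₅⟩ := nonempty_cochains_equiv_directSum (τ := M.actionOnCohomology) hτ n
  exact ⟨e₁.symm.trans (e₂.trans (e₃.symm.trans (e₄.trans e₅)))⟩
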